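/- Let $N\ge 1$, let $\omega\in\mathbb C$ be a primitive $N$-th root of unity and write $\mathbb Z_N=\mathbb Z/N\mathbb Z$. **Conventions.** A $\mathbb Z_N$-$C^*$-algebra is a unital $C^*$-algebra $X$ with a unital $*$-homomorphism $\rho^X:X\to X\otimes C(\mathbb Z_N)\cong C(\mathbb Z_N,X)$, $\rho^X(x)(t)=\rho^X_t(x)$, satisfying $(\rho^X\otimes\mathrm{id})\rho^X=(\mathrm{id}\otimes\Delta_{\mathbb Z_N})\rho^X$ and such that the closed linear span of $\rho^X(X)(1\otimes C(\mathbb Z_N))$ is $X\otimes C(\mathbb Z_N)$. A unital $*$-homomorphism $\phi:X\to Y$ is equivariant if $\rho^Y_t\circ\phi=\phi\circ\rho^X_t$ for all $t$. Let $X$ and $Y$ be faithfully represented on Hilbert spaces $\mathcal L^X,\mathcal L^Y$ carrying unitary representations $\pi^X,\pi^Y$ of $\mathbb Z_N$ such that $\rho_t(x)=\pi(t)\,x\,\pi(t)^*$ in each case. Let $c:\mathcal L^X\otimes\mathcal L^Y\to\mathcal L^Y\otimes\mathcal L^X$ be the unitary with $c(\xi\otimes\eta)=\omega^{mn}\,\eta\otimes\xi$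 whenever $\pi^X(t)\xi=\omega^{tm}\xi$ and $\pi^Y(t)\eta=\omega^{tn}\eta$ for all $t$. Put $j_1(x)=x\otimes\mathrm{id}$ and $j_2(y)=c^{-1}(y\otimes\mathrm{id})c$. The braided tensor product $X\boxtimes Y$ is the $C^*$-subalgebra of $\mathbb B(\mathcal L^X\otimes\mathcal L^Y)$ generated by the products $j_1(x)j_2(y)$. It is a $\mathbb Z_N$-$C^*$-algebra, with $\rho_t$ given by conjugation with $\pi^X(t)\otimes\pi^Y(t)$, and it is equivariantly represented on $\mathcal L^X\otimes\mathcal L^Y$. The morphisms $j_1,j_2$ are equivariant for this coaction. For equivariant $\phi:X\to X'$ and $\psi:Y\to Y'$, $\phi\boxtimes\psi:X\boxtimes Y\to X'\boxtimes Y'$ denotes the unique equivariant unital $*$-homomorphism with $(\phi\boxtimes\psi)(j_1(x)j_2(y))=j_1(\phi(x))j_2(\psi(y))$. The algebras $(X\boxtimes X)\boxtimes X$ and $X\boxtimes(X\boxtimes X)$ are identified through the associativity isomorphism of the Hilbert tensor product. An anyonic compact quantum group is a triple $(X,\rho,\Delta)$ in which $(X,\rho)$ is a $\mathbb Z_N$-$C^*$-algebra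 and $\Delta:X\to X\boxtimes X$ is an equivariant unital $*$-homomorphism that is coassociative, $(\Delta\boxtimes\mathrm{id})\Delta=(\mathrm{id}\boxtimes\Delta)\Delta$, and bisimplifiable: the closed linear spans of $\Delta(X)j_2(X)$ and of $\Delta(X)j_1(X)$ are both equal to $X\boxtimes X$. Let $C(U_N^+(R))$ be the universal unital $C^*$-algebra with generators $u_{ij}$, $i,j\in\mathbb Z_N$, subject to the relations making both $u=(u_{ij})$ and $\overline u_R=(\omega^{-i(j-i)}u_{ij}^*)$ unitary, with the coaction given by $\rho_t(u_{ij})=\omega^{t(j-i)}u_{ij}$. **Proposition.** $C(U_N^+(R))$ has a faithful equivariant representation as above. For every choice of such a representation (used for both factors of the braided tensor product) there is a unique unital $*$-homomorphism $$\Delta:C(U_N^+(R))\to C(U_N^+(R))\boxtimes C(U_N^+(R)),\qquad \Delta(u_{ij})=\sum_{k\in\mathbb Z_N}j_1(u_{ik})\,j_2(u_{kj})\quad(i,j\in\mathbb Z_N).$$ Moreover $\Delta$ is equivariant, coassociative and bisimplifiable. Hence $U_N^+(R)=(C(U_N^+(R)),\rho,\Delta)$ is an anyonic compact quantum group (the anyonic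 free unitary quantum group). -/

import Mathlib

noncomputable section

open scoped TensorProduct InnerProductSpace

/-! ### The free unital `*`-algebra -/

/-- The free unital complex `*`-algebra on a set `G` of generators: the free algebra on the letters
`(g, true)`, standing for `g`, and `(g, false)`, standing for the adjoint of `g`. -/
def FreeStar (G : Type) : Type := FreeAlgebra ℂ (G × Bool)

namespace FreeStar

variable {G : Type}

instance : Ring (FreeStar G) := inferInstanceAs (Ring (FreeAlgebra ℂ (G × Bool)))

instance : Algebra ℂ (FreeStar G) := inferInstanceAs (Algebra ℂ (FreeAlgebra ℂ (G × Bool)))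

/-- The letters: `(g, true)` is the generator `g` and `(g, false)` is its adjoint. -/
def letter (p : G × Bool) : FreeStar G := FreeAlgebra.ι ℂ p

/-- The generator `g`. -/
def gen (g : G) : FreeStar G := letter (g, true)

theorem induction {P : FreeStar G → Prop} (hs : ∀ c : ℂ, P (algebraMap ℂ (FreeStar G) c))
    (hl : ∀ p, P (letter p)) (hm : ∀ a b, P a → P b → P (a * b))
    (ha : ∀ a b, P a → P b → P (a + b)) (a : FreeStar G) : P a :=
  FreeAlgebra.induction (motive := P) ℂ (G × Bool) hs hl hm ha a

/-- The conjugate linear anti-endomorphism that exchanges each generator and its adjoint, as a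
ring homomorphism into the opposite ring. -/
def starHom : FreeStar G →+* (FreeStar G)ᵐᵒᵖ :=
  letI : Algebra ℂ (FreeStar G)ᵐᵒᵖ := Algebra.compHom _ (starRingEnd ℂ)
  (FreeAlgebra.lift ℂ fun p : G × Bool => MulOpposite.op (letter (p.1, !p.2)) :
    FreeAlgebra ℂ (G × Bool) →ₐ[ℂ] (FreeStar G)ᵐᵒᵖ).toRingHom

theorem starHom_letter (p : G × Bool) :
    starHom (letter p) = MulOpposite.op (letter (p.1, !p.2)) :=
  letI : Algebra ℂ (FreeStar G)ᵐᵒᵖ := Algebra.compHom _ (starRingEnd ℂ)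
  FreeAlgebra.lift_ι_apply (R := ℂ) (fun p : G × Bool => MulOpposite.op (letter (p.1, !p.2))) p

theorem starHom_algebraMap (c : ℂ) :
    starHom (algebraMap ℂ (FreeStar G) c)
      = MulOpposite.op (algebraMap ℂ (FreeStar G) (starRingEnd ℂ c)) :=
  letI : Algebra ℂ (FreeStar G)ᵐᵒᵖ := Algebra.compHom _ (starRingEnd ℂ)
  (FreeAlgebra.lift ℂ fun p : G × Bool => MulOpposite.op (letter (p.1, !p.2)) :
    FreeAlgebra ℂ (G × Bool) →ₐ[ℂ] (FreeStar G)ᵐᵒᵖ).commutes c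

instance : StarRing (FreeStar G) where
  star a := (starHom a).unop
  star_involutive a := by
    induction a using induction with
    | hs c => simp [starHom_algebraMap]
    | hl p => simp [starHom_letter]
    | hm a b iha ihb => simp [iha, ihb]
    | ha a b iha ihb => simp [iha, ihb]
  star_mul a b := by simp
  star_add a b := by simp

theorem star_def (a : FreeStar G) : star a = (starHom a).unop := rfl

instance : StarModule ℂ (FreeStar G) where
  star_smul c a := by
    rw [Algebra.smul_def, star_mul, star_def (algebraMap _ _ c), starHom_algebraMap,
      Algebra.smul_def, Algebra.commutes]
    rfl

variable {B : Type*} [Ring B] [Algebra ℂ B] [StarRing B] [StarModule ℂ B]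

/-- Evaluation of noncommutative `*`-polynomials, as an algebra homomorphism. -/
def liftAlg (v : G → B) : FreeStar G →ₐ[ℂ] B :=
  FreeAlgebra.lift ℂ fun p : G × Bool => if p.2 then v p.1 else star (v p.1)

theorem liftAlg_letter (v : G → B) (p : G × Bool) :
    liftAlg v (letter p) = if p.2 then v p.1 else star (v p.1) :=
  FreeAlgebra.lift_ι_apply (R := ℂ) (fun p : G × Bool => if p.2 then v p.1 else star (v p.1)) p

/-- Evaluation of noncommutative `*`-polynomials. -/
def lift (v : G → B) : FreeStar G →⋆ₐ[ℂ] B where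
  toAlgHom := liftAlg v
  map_star' a := by
    change liftAlg v (star a) = star (liftAlg v a)
    induction a using induction with
    | hs c =>
      rw [star_def, starHom_algebraMap, MulOpposite.unop_op, AlgHom.commutes, AlgHom.commutes,
        ← algebraMap_star_comm]
      rfl
    | hl p =>
      rw [star_def, starHom_letter, MulOpposite.unop_op, liftAlg_letter, liftAlg_letter]
      rcases p with ⟨g, b⟩
      cases b <;> simp
    | hm a b iha ihb => simp [iha, ihb]
    | ha a b iha ihb => simp [iha, ihb]

@[simp]
theorem lift_gen (v : G → B) (g : G) : lift v (gen g) = v g :=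
  (liftAlg_letter v (g, true)).trans (by simp)

theorem star_gen (g : G) : star (gen g) = letter (g, false) := by
  rw [star_def, gen, starHom_letter]; rfl

end FreeStar

/-! ### `C*`-seminorms and the completion -/

/-- A `C*`-seminorm on a complex `*`-algebra. -/
structure IsCStarSeminorm {F : Type*} [Ring F] [StarRing F] [Algebra ℂ F] (p : Seminorm ℂ F) :
    Prop where
  mul_le : ∀ a b, p (a * b) ≤ p a * p b
  star_mul_self : ∀ a, p (star a * a) = p a * p a

/-- A `*`-algebra `F`, topologized by the seminorm `p`. -/
def WithSN {F : Type*} [Ring F] [StarRing F] [Algebra ℂ F] {p : Seminorm ℂ F}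
    (_ : IsCStarSeminorm p) : Type _ := F

namespace WithSN

variable {F : Type*} [Ring F] [StarRing F] [Algebra ℂ F] [StarModule ℂ F] {p : Seminorm ℂ F}
  (hp : IsCStarSeminorm p)

instance : Ring (WithSN hp) := inferInstanceAs (Ring F)
instance : StarRing (WithSN hp) := inferInstanceAs (StarRing F)
instance : Algebra ℂ (WithSN hp) := inferInstanceAs (Algebra ℂ F)
instance : StarModule ℂ (WithSN hp) := inferInstanceAs (StarModule ℂ F)

/-- The identity map. -/
def toSN (a : F) : WithSN hp := a

/-- The identity map. -/
def ofSN (a : WithSN hp) : F := a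

instance : SeminormedRing (WithSN hp) where
  norm a := p (ofSN hp a)
  dist a b := p (ofSN hp a - ofSN hp b)
  dist_eq a b := by
    change p (ofSN hp a - ofSN hp b) = p (-ofSN hp a + ofSN hp b)
    rw [map_sub_rev, neg_add_eq_sub]
  dist_self a := by rw [sub_self, map_zero]
  dist_comm a b := map_sub_rev p _ _
  dist_triangle a b c := by
    have := map_add_le_add p (ofSN hp a - ofSN hp b) (ofSN hp b - ofSN hp c)
    rwa [sub_add_sub_cancel] at this
  norm_mul_le := hp.mul_le

theorem norm_toSN (a : F) : ‖toSN hp a‖ = p a := rfl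

instance : NormedAlgebra ℂ (WithSN hp) where
  __ : Algebra ℂ (WithSN hp) := inferInstance
  norm_smul_le c a := (map_smul_eq_mul p c a).le

theorem norm_star_le (a : WithSN hp) : ‖a‖ ≤ ‖star a‖ := by
  have h1 : ‖star a * a‖ = ‖a‖ * ‖a‖ := hp.star_mul_self a
  have h2 : ‖star a * a‖ ≤ ‖star a‖ * ‖a‖ := norm_mul_le _ _
  by_contra h
  push Not at h
  have h3 : 0 < ‖a‖ := lt_of_le_of_lt (norm_nonneg _) h
  nlinarith

theorem norm_star (a : WithSN hp) : ‖star a‖ = ‖a‖ :=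
  le_antisymm (by simpa using norm_star_le hp (star a)) (norm_star_le hp a)

/-- The adjoint as a continuous conjugate linear map. -/
def starL : WithSN hp →L⋆[ℂ] WithSN hp :=
  LinearMap.mkContinuous
    { toFun := fun a => star a
      map_add' := fun a b => star_add a b
      map_smul' := fun c a => star_smul c a } 1 fun a => by
        simpa using (norm_star hp a).le

@[simp]
theorem starL_apply (a : WithSN hp) : starL hp a = star a := rfl

end WithSN

/-- The Hausdorff completion of a `*`-algebra in a `C*`-seminorm. -/
def CStarCompletion {F : Type*} [Ring F] [StarRing F] [Algebra ℂ F] [StarModule ℂ F]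
    {p : Seminorm ℂ F} (hp : IsCStarSeminorm p) : Type _ :=
  UniformSpace.Completion (WithSN hp)

namespace CStarCompletion

open UniformSpace

variable {F : Type*} [Ring F] [StarRing F] [Algebra ℂ F] [StarModule ℂ F] {p : Seminorm ℂ F}
  (hp : IsCStarSeminorm p)

instance : NormedRing (CStarCompletion hp) := inferInstanceAs (NormedRing (Completion (WithSN hp)))

instance : CompleteSpace (CStarCompletion hp) :=
  inferInstanceAs (CompleteSpace (Completion (WithSN hp)))

instance : Algebra ℂ (CStarCompletion hp) :=
  inferInstanceAs (Algebra ℂ (Completion (WithSN hp)))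

instance : NormedAlgebra ℂ (CStarCompletion hp) where
  norm_smul_le := fun c (x : Completion (WithSN hp)) => norm_smul_le c x

/-- The canonical map into the completion. -/
def of (a : F) : CStarCompletion hp := Completion.coe' (WithSN.toSN hp a)

theorem norm_of (a : F) : ‖of hp a‖ = p a := Completion.norm_coe (WithSN.toSN hp a)

theorem denseRange_of : DenseRange (of hp) := Completion.denseRange_coe (α := WithSN hp)

theorem of_mul (a b : F) : of hp (a * b) = of hp a * of hp b :=
  Completion.coe_mul (α := WithSN hp) a b

theorem of_add (a b : F) : of hp (a + b) = of hp a + of hp b :=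
  Completion.coe_add (α := WithSN hp) a b

theorem of_smul (c : ℂ) (a : F) : of hp (c • a) = c • of hp a :=
  Completion.coe_smul (X := WithSN hp) c a

theorem of_one : of hp 1 = 1 := rfl

instance : Star (CStarCompletion hp) where
  star x := (WithSN.starL hp).completion x

theorem continuous_star' : Continuous fun x : CStarCompletion hp => star x :=
  (WithSN.starL hp).completion.continuous

theorem of_star (a : F) : of hp (star a) = star (of hp a) :=
  ((WithSN.starL hp).completion_apply_coe a).symm

theorem induction {P : CStarCompletion hp → Prop} (hc : IsClosed {x | P x})
    (h : ∀ a, P (of hp a)) (x : CStarCompletion hp) : P x :=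
  (denseRange_of hp).induction_on x hc h

instance : StarRing (CStarCompletion hp) where
  star_involutive x := by
    refine induction hp (P := fun x => star (star x) = x) ?_ ?_ x
    · exact isClosed_eq ((continuous_star' hp).comp (continuous_star' hp)) continuous_id
    · intro a
      rw [← of_star, ← of_star, star_star]
  star_add x y := (WithSN.starL hp).completion.map_add x y
  star_mul x y := by
    have hs := continuous_star' hp
    refine (denseRange_of hp).induction_on₂ (p := fun x y => star (x * y) = star y * star x)
      (isClosed_eq ?_ ?_) ?_ x y
    · exact hs.comp (continuous_fst.mul continuous_snd)
    · exact (hs.comp continuous_snd).mul (hs.comp continuous_fst)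
    · intro a b
      rw [← of_mul, ← of_star, ← of_star, ← of_star, ← of_mul, star_mul]

instance : StarModule ℂ (CStarCompletion hp) where
  star_smul c x := (WithSN.starL hp).completion.map_smulₛₗ c x

instance : CStarRing (CStarCompletion hp) where
  norm_mul_self_le x := by
    refine induction hp (P := fun x => ‖x‖ * ‖x‖ ≤ ‖star x * x‖) (isClosed_le ?_ ?_) ?_ x
    · exact continuous_norm.mul continuous_norm
    · exact continuous_norm.comp ((continuous_star' hp).mul continuous_id)
    · intro a
      rw [← of_star, ← of_mul, norm_of, norm_of, hp.star_mul_self]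

instance : CStarAlgebra (CStarCompletion hp) where

/-- The canonical map into the completion, as a unital `*`-homomorphism. -/
def ofHom : F →⋆ₐ[ℂ] CStarCompletion hp where
  toFun := of hp
  map_one' := of_one hp
  map_mul' := of_mul hp
  map_zero' := by simpa using of_smul hp 0 0
  map_add' := of_add hp
  commutes' c := by
    rw [Algebra.algebraMap_eq_smul_one, of_smul, of_one, Algebra.algebraMap_eq_smul_one]
  map_star' := of_star hp

/-- Extension of a unital `*`-homomorphism to the completion, as a continuous linear map. -/
def extendL {B : Type*} [CStarAlgebra B] (f : F →⋆ₐ[ℂ] B) (hf : ∀ a, ‖f a‖ ≤ p a) :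
    CStarCompletion hp →L[ℂ] B :=
  let L : WithSN hp →L[ℂ] B := LinearMap.mkContinuous (f.toAlgHom.toLinearMap) 1 fun a => by
    rw [one_mul]; exact hf a
  L.fromCompletion

theorem extendL_of {B : Type*} [CStarAlgebra B] (f : F →⋆ₐ[ℂ] B) (hf : ∀ a, ‖f a‖ ≤ p a)
    (a : F) : extendL hp f hf (of hp a) = f a :=
  ContinuousLinearMap.fromCompletion_apply_coe _ (WithSN.toSN hp a)

/-- Extension of a unital `*`-homomorphism to the completion. -/
def extend {B : Type*} [CStarAlgebra B] (f : F →⋆ₐ[ℂ] B) (hf : ∀ a, ‖f a‖ ≤ p a) :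
    CStarCompletion hp →⋆ₐ[ℂ] B where
  toFun := extendL hp f hf
  map_one' := by rw [← of_one, extendL_of, map_one]
  map_mul' x y := by
    have hc := (extendL hp f hf).continuous
    refine (denseRange_of hp).induction_on₂ (p := fun x y =>
      extendL hp f hf (x * y) = extendL hp f hf x * extendL hp f hf y)
      (isClosed_eq ?_ ?_) ?_ x y
    · exact hc.comp (continuous_fst.mul continuous_snd)
    · exact (hc.comp continuous_fst).mul (hc.comp continuous_snd)
    · intro a b
      rw [← of_mul, extendL_of, extendL_of, extendL_of, map_mul]
  map_zero' := map_zero _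
  map_add' x y := map_add _ x y
  commutes' c := by
    rw [Algebra.algebraMap_eq_smul_one, ← of_one, ← of_smul, extendL_of, map_smul, map_one,
      Algebra.algebraMap_eq_smul_one]
  map_star' x := by
    have hc := (extendL hp f hf).continuous
    refine induction hp (P := fun x => extendL hp f hf (star x) = star (extendL hp f hf x))
      (isClosed_eq ?_ ?_) ?_ x
    · exact hc.comp (continuous_star' hp)
    · exact hc.star
    · intro a
      rw [← of_star, extendL_of, extendL_of, map_star]

theorem extend_of {B : Type*} [CStarAlgebra B] (f : F →⋆ₐ[ℂ] B) (hf : ∀ a, ‖f a‖ ≤ p a) (a : F) :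
    extend hp f hf (of hp a) = f a :=
  extendL_of hp f hf a

end CStarCompletion

/-! ### Universal `C*`-algebras of generators and relations -/

/-- The `C*`-seminorms on the free `*`-algebra that vanish on the relations `R`, that is, the
`C*`-seminorms on the universal unital `*`-algebra with these generators and relations. -/
def cstarSeminorms {G : Type} (R : Set (FreeStar G)) : Set (Seminorm ℂ (FreeStar G)) :=
  {p | IsCStarSeminorm p ∧ ∀ r ∈ R, p r = 0}

/-- The largest of these `C*`-seminorms (zero if there is no largest one). -/
def maxSeminorm {G : Type} (R : Set (FreeStar G)) : Seminorm ℂ (FreeStar G) :=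
  sSup (cstarSeminorms R)

theorem isCStarSeminorm_maxSeminorm {G : Type} (R : Set (FreeStar G)) :
    IsCStarSeminorm (maxSeminorm R) := by
  have hz : IsCStarSeminorm (0 : Seminorm ℂ (FreeStar G)) := ⟨by simp, by simp⟩
  by_cases h : BddAbove (cstarSeminorms R)
  · have hne : Nonempty (cstarSeminorms R) := ⟨⟨0, hz, by simp⟩⟩
    have hle : ∀ p ∈ cstarSeminorms R, ∀ a, p a ≤ maxSeminorm R a :=
      fun p hp a => (le_csSup h hp) a
    have happ : ∀ a, maxSeminorm R a = ⨆ p : cstarSeminorms R, (p : FreeStar G → ℝ) a :=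
      fun a => Seminorm.sSup_apply h
    constructor
    · intro a b
      rw [happ (a * b)]
      refine ciSup_le fun p => (p.2.1.mul_le a b).trans ?_
      exact mul_le_mul (hle _ p.2 a) (hle _ p.2 b) (apply_nonneg _ _) (apply_nonneg _ _)
    · intro a
      refine le_antisymm ?_ ?_
      · rw [happ (star a * a)]
        refine ciSup_le fun p => ?_
        rw [p.2.1.star_mul_self]
        exact mul_le_mul (hle _ p.2 a) (hle _ p.2 a) (apply_nonneg _ _) (apply_nonneg _ _)
      · have h1 : maxSeminorm R a ≤ Real.sqrt (maxSeminorm R (star a * a)) := by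
          rw [happ a]
          refine ciSup_le fun p => Real.le_sqrt_of_sq_le ?_
          rw [sq, ← p.2.1.star_mul_self]
          exact hle _ p.2 _
        calc _ ≤ _ := mul_le_mul h1 h1 (apply_nonneg _ _) (Real.sqrt_nonneg _)
          _ = _ := Real.mul_self_sqrt (apply_nonneg _ _)
  · have : maxSeminorm R = 0 := by
      have h' := fun H => h (Seminorm.bddAbove_iff.mpr H)
      exact dif_neg h'
    rw [this]
    exact hz

/-- The universal unital `C*`-algebra with generators `G` and relations `R`. -/
abbrev UniversalCStar {G : Type} (R : Set (FreeStar G)) : Type :=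
  CStarCompletion (isCStarSeminorm_maxSeminorm R)

/-! ### Matrices, unitarity and the twisted conjugate -/

/-- The character value `ω ^ x` for `x` in `ℤ/Nℤ`. -/
def chi {N : ℕ} (ω : ℂ) (x : ZMod N) : ℂ := ω ^ x.val

section chi

variable {N : ℕ} [NeZero N] {ω : ℂ}

theorem chi_add (hω : IsPrimitiveRoot ω N) (x y : ZMod N) : chi ω (x + y) = chi ω x * chi ω y := by
  unfold chi
  rw [ZMod.val_add, ← pow_add]
  exact (pow_eq_pow_mod _ hω.pow_eq_one).symm

theorem star_chi (hω : IsPrimitiveRoot ω N) (x : ZMod N) : star (chi ω x) = chi ω (-x) := by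
  have h1 : chi ω x * chi ω (-x) = 1 := by
    rw [← chi_add hω, add_neg_cancel]
    simp [chi]
  have h2 : star (chi ω x) * chi ω x = 1 := by
    have hn : ‖ω‖ = 1 := hω.norm'_eq_one (NeZero.ne N)
    have hx : ‖chi ω x‖ = 1 := by simp [chi, hn]
    rw [Complex.star_def, Complex.conj_mul', hx]
    simp
  calc star (chi ω x) = star (chi ω x) * (chi ω x * chi ω (-x)) := by rw [h1, mul_one]
    _ = chi ω (-x) := by rw [← mul_assoc, h2, one_mul]

theorem sum_chi (hω : IsPrimitiveRoot ω N) (x : ZMod N) :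
    ∑ t : ZMod N, chi ω (t * x) = if x = 0 then (N : ℂ) else 0 := by
  split_ifs with hx
  · simp [hx, chi]
  · have h1 : chi ω x ≠ 1 := by
      intro h
      have hd := (hω.pow_eq_one_iff_dvd _).mp h
      have := Nat.eq_zero_of_dvd_of_lt hd (ZMod.val_lt x)
      exact hx ((ZMod.val_eq_zero x).mp this)
    have h2 : chi ω x * ∑ t : ZMod N, chi ω (t * x) = ∑ t : ZMod N, chi ω (t * x) := by
      rw [Finset.mul_sum]
      refine Fintype.sum_equiv (Equiv.addLeft 1) _ _ fun t => ?_
      rw [← chi_add hω, Equiv.coe_addLeft, add_mul, one_mul]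
    have h3 : (chi ω x - 1) * ∑ t : ZMod N, chi ω (t * x) = 0 := by
      rw [sub_mul, h2, one_mul, sub_self]
    exact (mul_eq_zero.mp h3).resolve_left (sub_ne_zero.mpr h1)

end chi

theorem chi_zero {N : ℕ} (ω : ℂ) : chi ω (0 : ZMod N) = 1 := by
  simp [chi]

section matrix

variable {N : ℕ} [NeZero N]

/-- The twisted conjugate `(ω ^ (-i(j-i)) v_ij^*)_ij` of a matrix `v`. -/
def twistedConj {B : Type*} [Star B] [SMul ℂ B] (ω : ℂ) (v : Matrix (ZMod N) (ZMod N) B) :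
    Matrix (ZMod N) (ZMod N) B :=
  Matrix.of fun i j => chi ω (-(i * (j - i))) • star (v i j)

/-- The elements that have to vanish for `v` to be unitary. -/
def unitaryRel {B : Type*} [Ring B] [StarRing B] (v : Matrix (ZMod N) (ZMod N) B) : Set B :=
  {r | ∃ i j, r = (star v * v - 1) i j ∨ r = (v * star v - 1) i j}

variable {A B : Type*} [Ring A] [StarRing A] [Algebra ℂ A] [StarModule ℂ A]
  [Ring B] [StarRing B] [Algebra ℂ B] [StarModule ℂ B]

theorem map_twistedConj (ω : ℂ) (φ : A →⋆ₐ[ℂ] B) (v : Matrix (ZMod N) (ZMod N) A) :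
    (twistedConj ω v).map φ = twistedConj ω (v.map φ) := by
  ext i j
  simp [twistedConj, map_star]

theorem map_mem_unitary_iff (φ : A →⋆ₐ[ℂ] B) (v : Matrix (ZMod N) (ZMod N) A) :
    v.map φ ∈ unitary (Matrix (ZMod N) (ZMod N) B) ↔ ∀ r ∈ unitaryRel v, φ r = 0 := by
  have e1 : star (v.map φ) * v.map φ - 1 = (star v * v - 1).map φ := by
    ext i j
    simp [Matrix.mul_apply, Matrix.one_apply, map_star, apply_ite φ, Matrix.star_apply]
  have e2 : v.map φ * star (v.map φ) - 1 = (v * star v - 1).map φ := by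
    ext i j
    simp [Matrix.mul_apply, Matrix.one_apply, map_star, apply_ite φ, Matrix.star_apply]
  rw [Unitary.mem_iff, ← sub_eq_zero, e1, ← sub_eq_zero (a := v.map φ * _), e2]
  constructor
  · rintro ⟨h1, h2⟩ r ⟨i, j, rfl | rfl⟩
    · exact congrFun (congrFun h1 i) j
    · exact congrFun (congrFun h2 i) j
  · intro h
    exact ⟨Matrix.ext fun i j => h _ ⟨i, j, Or.inl rfl⟩,
      Matrix.ext fun i j => h _ ⟨i, j, Or.inr rfl⟩⟩

theorem diag_mem_unitary {d : ZMod N → ℂ} (hd : ∀ i, star (d i) * d i = 1)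
    {v : Matrix (ZMod N) (ZMod N) B} (hv : v ∈ unitary (Matrix (ZMod N) (ZMod N) B)) :
    (Matrix.of fun i j => (star (d i) * d j) • v i j) ∈ unitary (Matrix (ZMod N) (ZMod N) B) := by
  have hd' : ∀ i, d i * star (d i) = 1 := fun i => by rw [mul_comm]; exact hd i
  have hD : Matrix.diagonal (fun i => algebraMap ℂ B (d i)) ∈
      unitary (Matrix (ZMod N) (ZMod N) B) := by
    rw [Unitary.mem_iff, Matrix.star_eq_conjTranspose, Matrix.diagonal_conjTranspose,
      Matrix.diagonal_mul_diagonal, Matrix.diagonal_mul_diagonal]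
    constructor
    · rw [← Matrix.diagonal_one]
      congr 1
      ext i
      rw [Pi.star_apply, ← algebraMap_star_comm, ← map_mul, hd, map_one]
    · rw [← Matrix.diagonal_one]
      congr 1
      ext i
      rw [Pi.star_apply, ← algebraMap_star_comm, ← map_mul, hd', map_one]
  have e : (Matrix.of fun i j => (star (d i) * d j) • v i j) =
      star (Matrix.diagonal fun i => algebraMap ℂ B (d i)) * v *
        Matrix.diagonal fun i => algebraMap ℂ B (d i) := by
    ext i j
    rw [Matrix.mul_diagonal, Matrix.star_eq_conjTranspose, Matrix.diagonal_conjTranspose,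
      Matrix.diagonal_mul, Pi.star_apply, ← algebraMap_star_comm, ← Algebra.commutes,
      Matrix.of_apply, Algebra.smul_def, map_mul, ← mul_assoc, ← map_mul, ← map_mul, mul_comm]
  rw [e]
  exact mul_mem (mul_mem (Unitary.star_mem hD) hv) hD

end matrix

theorem norm_entry_le_one {n : Type*} [Fintype n] [DecidableEq n] {B : Type*} [CStarAlgebra B]
    {v : Matrix n n B} (hv : v ∈ unitary (Matrix n n B)) (i j : n) : ‖v i j‖ ≤ 1 := by
  let _ := CStarAlgebra.spectralOrder B
  have _ := CStarAlgebra.spectralOrderedRing B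
  have h1 : ∑ k, star (v k j) * v k j = 1 := by
    have := congrFun (congrFun (Unitary.mem_iff.mp hv).1 j) j
    simpa [Matrix.mul_apply, Matrix.star_apply] using this
  have h2 : star (v i j) * v i j ≤ 1 := by
    rw [← h1]
    exact Finset.single_le_sum (f := fun k => star (v k j) * v k j)
      (fun k _ => star_mul_self_nonneg _) (Finset.mem_univ i)
  have h3 : ‖star (v i j) * v i j‖ ≤ 1 :=
    CStarAlgebra.norm_le_one_iff_of_nonneg _ (star_mul_self_nonneg _) |>.mpr h2
  rw [CStarRing.norm_star_mul_self] at h3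
  nlinarith [norm_nonneg (v i j)]

open scoped CStarAlgebra in
theorem continuous_hom {A B : Type*} [CStarAlgebra A] [CStarAlgebra B] (f : A →⋆ₐ[ℂ] B) :
    Continuous f :=
  map_continuous f

/-! ### The algebra `C(U_N^+(R))` -/

section freeUnitary

variable (N : ℕ) [NeZero N] (ω : ℂ)

/-- The matrix of generators in the free `*`-algebra. -/
def freeMatrix : Matrix (ZMod N) (ZMod N) (FreeStar (ZMod N × ZMod N)) :=
  Matrix.of fun i j => FreeStar.gen (i, j)

/-- The relations that make the matrix of generators and its twisted conjugate unitary. -/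
def freeUnitaryRel : Set (FreeStar (ZMod N × ZMod N)) :=
  unitaryRel (freeMatrix N) ∪ unitaryRel (twistedConj ω (freeMatrix N))

/-- The algebra `C(U_N^+(R))`: the universal unital `C*`-algebra whose generators `u_ij` make both
`u` and its twisted conjugate unitary. -/
abbrev FreeUnitary : Type := UniversalCStar (freeUnitaryRel N ω)

namespace FreeUnitary

/-- The matrix `u` of canonical generators. -/
def u : Matrix (ZMod N) (ZMod N) (FreeUnitary N ω) :=
  Matrix.of fun i j =>
    CStarCompletion.of (isCStarSeminorm_maxSeminorm (freeUnitaryRel N ω)) (FreeStar.gen (i, j))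

theorem bddAbove_cstarSeminorms : BddAbove (cstarSeminorms (freeUnitaryRel N ω)) := by
  rw [Seminorm.bddAbove_iff]
  have hl : ∀ p ∈ cstarSeminorms (freeUnitaryRel N ω), ∀ q, p (FreeStar.letter q) ≤ 1 := by
    intro p hp q
    have hU : (freeMatrix N).map (CStarCompletion.ofHom hp.1) ∈ unitary (Matrix _ _ _) :=
      (map_mem_unitary_iff _ _).mpr fun r hr => norm_eq_zero.mp
        ((CStarCompletion.norm_of hp.1 r).trans (hp.2 r (Or.inl hr)))
    have hg : ‖CStarCompletion.ofHom hp.1 (FreeStar.gen q.1)‖ ≤ 1 :=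
      norm_entry_le_one hU q.1.1 q.1.2
    rw [← CStarCompletion.norm_of hp.1]
    rcases q with ⟨g, b⟩
    cases b
    · rw [← FreeStar.star_gen, CStarCompletion.of_star, norm_star]
      exact hg
    · exact hg
  have hb : ∀ a, ∃ C, ∀ p ∈ cstarSeminorms (freeUnitaryRel N ω), p a ≤ C := by
    intro a
    induction a using FreeStar.induction with
    | hs c =>
      refine ⟨‖c‖, fun p hp => ?_⟩
      rw [Algebra.algebraMap_eq_smul_one, map_smul_eq_mul]
      have h1 := hp.1.star_mul_self 1
      rw [star_one, mul_one] at h1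
      have h2 : p 1 ≤ 1 := by nlinarith [apply_nonneg p 1, sq_nonneg (p 1 - 1)]
      exact mul_le_of_le_one_right (norm_nonneg c) h2
    | hl q => exact ⟨1, fun p hp => hl p hp q⟩
    | hm a b iha ihb =>
      obtain ⟨C, hC⟩ := iha
      obtain ⟨D, hD⟩ := ihb
      refine ⟨C * D, fun p hp => (hp.1.mul_le a b).trans ?_⟩
      exact mul_le_mul (hC p hp) (hD p hp) (apply_nonneg p b)
        ((apply_nonneg p a).trans (hC p hp))
    | ha a b iha ihb =>
      obtain ⟨C, hC⟩ := iha
      obtain ⟨D, hD⟩ := ihb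
      exact ⟨C + D, fun p hp => (map_add_le_add p a b).trans (add_le_add (hC p hp) (hD p hp))⟩
  choose C hC using hb
  refine ⟨C, ?_⟩
  rintro _ ⟨p, hp, rfl⟩ a
  exact hC a p hp

theorem maxSeminorm_rel {r : FreeStar (ZMod N × ZMod N)} (hr : r ∈ freeUnitaryRel N ω) :
    maxSeminorm (freeUnitaryRel N ω) r = 0 := by
  have hne : Nonempty (cstarSeminorms (freeUnitaryRel N ω)) :=
    ⟨⟨0, ⟨by simp, by simp⟩, by simp⟩⟩
  refine le_antisymm ?_ (apply_nonneg _ _)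
  refine (Seminorm.sSup_apply (bddAbove_cstarSeminorms N ω)).trans_le ?_
  exact ciSup_le fun p => (p.2.2 r hr).le

theorem u_mem_unitary : u N ω ∈ unitary (Matrix (ZMod N) (ZMod N) (FreeUnitary N ω)) :=
  (map_mem_unitary_iff (CStarCompletion.ofHom _) (freeMatrix N)).mpr fun r hr =>
    norm_eq_zero.mp ((CStarCompletion.norm_of _ r).trans (maxSeminorm_rel N ω (Or.inl hr)))

theorem twistedConj_u_mem_unitary :
    twistedConj ω (u N ω) ∈ unitary (Matrix (ZMod N) (ZMod N) (FreeUnitary N ω)) := by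
  have := (map_mem_unitary_iff (CStarCompletion.ofHom
    (isCStarSeminorm_maxSeminorm (freeUnitaryRel N ω))) (twistedConj ω (freeMatrix N))).mpr
    fun r hr =>
    norm_eq_zero.mp ((CStarCompletion.norm_of _ r).trans (maxSeminorm_rel N ω (Or.inr hr)))
  rwa [map_twistedConj] at this

variable {N ω} {B : Type*} [CStarAlgebra B]

theorem norm_lift_le {v : Matrix (ZMod N) (ZMod N) B}
    (h1 : v ∈ unitary (Matrix (ZMod N) (ZMod N) B))
    (h2 : twistedConj ω v ∈ unitary (Matrix (ZMod N) (ZMod N) B))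
    (a : FreeStar (ZMod N × ZMod N)) :
    ‖FreeStar.lift (fun p : ZMod N × ZMod N => v p.1 p.2) a‖ ≤
      maxSeminorm (freeUnitaryRel N ω) a := by
  have h := fun r : Matrix (ZMod N) (ZMod N) (FreeStar (ZMod N × ZMod N)) =>
    (map_mem_unitary_iff (FreeStar.lift fun p : ZMod N × ZMod N => v p.1 p.2) r).mp
  have hm : (freeMatrix N).map (FreeStar.lift fun p : ZMod N × ZMod N => v p.1 p.2) = v := by
    ext i j
    simp [freeMatrix]
  let q : Seminorm ℂ (FreeStar (ZMod N × ZMod N)) := (normSeminorm ℂ B).comp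
    (FreeStar.lift fun p : ZMod N × ZMod N => v p.1 p.2).toAlgHom.toLinearMap
  have hq : ∀ a, q a = ‖FreeStar.lift (fun p : ZMod N × ZMod N => v p.1 p.2) a‖ := fun a => rfl
  have hqmem : q ∈ cstarSeminorms (freeUnitaryRel N ω) := by
    refine ⟨⟨fun a b => ?_, fun a => ?_⟩, fun r hr => ?_⟩
    · rw [hq, hq, hq, map_mul]
      exact norm_mul_le _ _
    · rw [hq, hq, map_mul, map_star, CStarRing.norm_star_mul_self]
    · rw [hq, norm_eq_zero]
      rcases hr with hr | hr
      · exact h _ (by rwa [hm]) r hr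
      · exact h _ (by rwa [map_twistedConj, hm]) r hr
  exact le_csSup (bddAbove_cstarSeminorms N ω) hqmem a

/-- The universal property: matrices that are unitary together with their twisted conjugate are
the images of `u` under unital `*`-homomorphisms. -/
def lift (v : Matrix (ZMod N) (ZMod N) B)
    (h1 : v ∈ unitary (Matrix (ZMod N) (ZMod N) B))
    (h2 : twistedConj ω v ∈ unitary (Matrix (ZMod N) (ZMod N) B)) : FreeUnitary N ω →⋆ₐ[ℂ] B :=
  CStarCompletion.extend _ (FreeStar.lift fun p : ZMod N × ZMod N => v p.1 p.2)
    (norm_lift_le h1 h2)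

theorem lift_u (v : Matrix (ZMod N) (ZMod N) B)
    (h1 : v ∈ unitary (Matrix (ZMod N) (ZMod N) B))
    (h2 : twistedConj ω v ∈ unitary (Matrix (ZMod N) (ZMod N) B)) (i j : ZMod N) :
    lift v h1 h2 (u N ω i j) = v i j :=
  (CStarCompletion.extend_of _ _ _ _).trans (FreeStar.lift_gen _ _)

theorem hom_ext {f g : FreeUnitary N ω →⋆ₐ[ℂ] B} (h : ∀ i j, f (u N ω i j) = g (u N ω i j)) :
    f = g := by
  have key : ∀ a, f (CStarCompletion.of _ a) = g (CStarCompletion.of _ a) := by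
    intro a
    change f (CStarCompletion.ofHom _ a) = g (CStarCompletion.ofHom _ a)
    induction a using FreeStar.induction with
    | hs c => simp only [AlgHomClass.commutes]
    | hl q =>
      rcases q with ⟨⟨i, j⟩, b⟩
      cases b
      · rw [← FreeStar.star_gen, map_star, map_star, map_star]
        exact congrArg star (h i j)
      · exact h i j
    | hm a b iha ihb => rw [map_mul, map_mul, map_mul, iha, ihb]
    | ha a b iha ihb => rw [map_add, map_add, map_add, iha, ihb]
  have hf : Continuous f := continuous_hom f
  have hg : Continuous g := continuous_hom g
  ext x
  exact CStarCompletion.induction _ (P := fun x => f x = g x)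
    (isClosed_eq hf hg) key x

end FreeUnitary

end freeUnitary

/-! ### Actions of `ℤ/Nℤ` on unital `C*`-algebras -/

/-- A coaction of `C(ℤ/Nℤ)` on a unital `C*`-algebra `X`, where `X ⊗ C(ℤ/Nℤ)` is identified with the
algebra of all functions `ℤ/Nℤ → X`; the comultiplication of `C(ℤ/Nℤ)` is dual to the addition of
`ℤ/Nℤ`. -/
structure ZNAction (N : ℕ) [NeZero N] (X : Type*) [CStarAlgebra X] where
  /-- The coaction. -/
  ρ : X →⋆ₐ[ℂ] (ZMod N → X)
  /-- Coassociativity. -/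
  coassoc : ∀ x s t, ρ (ρ x t) s = ρ x (s + t)
  /-- The elements `ρ x * (1 ⊗ f)` span a dense subspace. -/
  podles : (Submodule.span ℂ {F : ZMod N → X | ∃ (x : X) (f : ZMod N → ℂ),
    F = ρ x * fun t => algebraMap ℂ X (f t)}).topologicalClosure = ⊤

namespace ZNAction

variable {N : ℕ} [NeZero N] {X Y : Type*} [CStarAlgebra X] [CStarAlgebra Y]

/-- The coaction that belongs to a group action by automorphisms. -/
def ofFamily (σ : ZMod N → X →⋆ₐ[ℂ] X) (h0 : ∀ x, σ 0 x = x)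
    (hadd : ∀ s t x, σ s (σ t x) = σ (s + t) x) : ZNAction N X where
  ρ :=
    { toFun := fun x t => σ t x
      map_one' := by ext; simp
      map_mul' := fun x y => by ext; simp
      map_zero' := by ext; simp
      map_add' := fun x y => by ext; simp
      commutes' := fun c => by ext; simp [Algebra.algebraMap_eq_smul_one]
      map_star' := fun x => by ext; simp [map_star] }
  coassoc x s t := hadd s t x
  podles := by
    refine Submodule.eq_top_iff'.mpr fun y => Submodule.le_topologicalClosure _ ?_
    have hy : y = ∑ t, Pi.single t (y t) := (Finset.univ_sum_single y).symm
    rw [hy]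
    refine Submodule.sum_mem _ fun t _ => Submodule.subset_span
      ⟨σ (-t) (y t), fun s => if s = t then 1 else 0, ?_⟩
    ext s
    by_cases hs : s = t
    · subst hs
      simp [hadd, h0]
    · simp [hs]

/-- Equivariance of a unital `*`-homomorphism. -/
def IsEquivariant (α : ZNAction N X) (β : ZNAction N Y) (φ : X →⋆ₐ[ℂ] Y) : Prop :=
  ∀ x t, β.ρ (φ x) t = φ (α.ρ x t)

end ZNAction

/-- The automorphism `u_ij ↦ ω ^ (t(j-i)) u_ij` of `C(U_N^+(R))`. -/
def FreeUnitary.rot {N : ℕ} [NeZero N] {ω : ℂ} (hω : IsPrimitiveRoot ω N) (t : ZMod N) :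
    FreeUnitary N ω →⋆ₐ[ℂ] FreeUnitary N ω :=
  FreeUnitary.lift (Matrix.of fun i j => chi ω (t * (j - i)) • FreeUnitary.u N ω i j)
    (by
      have := diag_mem_unitary (d := fun i => chi ω (t * i))
        (fun i => by rw [star_chi hω, ← chi_add hω, neg_add_cancel, chi_zero])
        (FreeUnitary.u_mem_unitary N ω)
      simpa only [star_chi hω, ← chi_add hω, ← mul_neg, ← mul_add, neg_add_eq_sub] using this)
    (by
      have := diag_mem_unitary (d := fun i => chi ω (-(t * i)))
        (fun i => by rw [star_chi hω, ← chi_add hω, neg_add_cancel, chi_zero])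
        (FreeUnitary.twistedConj_u_mem_unitary N ω)
      convert this using 1
      ext i j
      simp only [twistedConj, Matrix.of_apply, star_smul, smul_smul, star_chi hω, ← chi_add hω]
      congr 2
      ring)

theorem FreeUnitary.rot_u {N : ℕ} [NeZero N] {ω : ℂ} (hω : IsPrimitiveRoot ω N) (t i j : ZMod N) :
    FreeUnitary.rot hω t (FreeUnitary.u N ω i j)
      = chi ω (t * (j - i)) • FreeUnitary.u N ω i j :=
  FreeUnitary.lift_u _ _ _ i j

/-- The coaction on `C(U_N^+(R))`, with `ρ_t(u_ij) = ω ^ (t(j-i)) u_ij`. -/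
def FreeUnitary.action {N : ℕ} [NeZero N] {ω : ℂ} (hω : IsPrimitiveRoot ω N) :
    ZNAction N (FreeUnitary N ω) :=
  ZNAction.ofFamily (FreeUnitary.rot hω)
    (fun x => DFunLike.congr_fun (FreeUnitary.hom_ext (f := FreeUnitary.rot hω 0)
      (g := StarAlgHom.id ℂ _) fun i j => by
        rw [FreeUnitary.rot_u, zero_mul, chi_zero, one_smul]; rfl) x)
    (fun s t x => DFunLike.congr_fun (FreeUnitary.hom_ext
      (f := (FreeUnitary.rot hω s).comp (FreeUnitary.rot hω t))
      (g := FreeUnitary.rot hω (s + t)) fun i j => by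
        rw [StarAlgHom.comp_apply, FreeUnitary.rot_u, FreeUnitary.rot_u, map_smul,
          FreeUnitary.rot_u, smul_smul, add_mul, chi_add hω, mul_comm]) x)

/-! ### Hilbert space tensor products -/

section hilbert

open UniformSpace

variable {E F G H : Type*} [NormedAddCommGroup E] [InnerProductSpace ℂ E]
  [NormedAddCommGroup F] [InnerProductSpace ℂ F] [NormedAddCommGroup G] [InnerProductSpace ℂ G]
  [NormedAddCommGroup H] [InnerProductSpace ℂ H]

/-- The Hilbert space tensor product. -/
def HilbertTensor (E F : Type*) [NormedAddCommGroup E] [InnerProductSpace ℂ E]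
    [NormedAddCommGroup F] [InnerProductSpace ℂ F] : Type _ :=
  Completion (E ⊗[ℂ] F)

namespace HilbertTensor

instance : NormedAddCommGroup (HilbertTensor E F) :=
  inferInstanceAs (NormedAddCommGroup (Completion (E ⊗[ℂ] F)))

instance : InnerProductSpace ℂ (HilbertTensor E F) :=
  inferInstanceAs (InnerProductSpace ℂ (Completion (E ⊗[ℂ] F)))

instance : CompleteSpace (HilbertTensor E F) :=
  inferInstanceAs (CompleteSpace (Completion (E ⊗[ℂ] F)))

/-- The embedding of the algebraic tensor product. -/
def coeL (E F : Type*) [NormedAddCommGroup E] [InnerProductSpace ℂ E]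
    [NormedAddCommGroup F] [InnerProductSpace ℂ F] : E ⊗[ℂ] F →L[ℂ] HilbertTensor E F :=
  Completion.toComplL (𝕜 := ℂ) (E := E ⊗[ℂ] F)

theorem denseRange_coeL : DenseRange (coeL E F) := Completion.denseRange_coe (α := E ⊗[ℂ] F)

theorem norm_coeL (z : E ⊗[ℂ] F) : ‖coeL E F z‖ = ‖z‖ := Completion.norm_coe z

theorem inner_coeL (z w : E ⊗[ℂ] F) : inner ℂ (coeL E F z) (coeL E F w) = inner ℂ z w :=
  Completion.inner_coe z w

/-- The elementary tensor `x ⊗ y`. -/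
def tmul (x : E) (y : F) : HilbertTensor E F := coeL E F (x ⊗ₜ[ℂ] y)

theorem ext_tmul {X : Type*} [NormedAddCommGroup X] [NormedSpace ℂ X]
    {S T : HilbertTensor E F →L[ℂ] X}
    (h : ∀ x y, S (tmul x y) = T (tmul x y)) : S = T := by
  ext z
  refine denseRange_coeL.induction_on z (isClosed_eq S.continuous T.continuous) fun w => ?_
  induction w using TensorProduct.induction_on with
  | zero => simp
  | tmul x y => exact h x y
  | add a b ha hb => rw [map_add, map_add, map_add, ha, hb]

theorem inner_tmul (x x' : E) (y y' : F) :
    inner ℂ (tmul x y) (tmul x' y') = inner ℂ x x' * inner ℂ y y' := by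
  rw [tmul, tmul, inner_coeL, TensorProduct.inner_tmul]

theorem add_tmul (x x' : E) (y : F) : tmul (x + x') y = tmul x y + tmul x' y := by
  simp only [tmul, TensorProduct.add_tmul, map_add]

theorem tmul_add (x : E) (y y' : F) : tmul x (y + y') = tmul x y + tmul x y' := by
  simp only [tmul, TensorProduct.tmul_add, map_add]

theorem smul_tmul (c : ℂ) (x : E) (y : F) : tmul (c • x) y = c • tmul x y := by
  simp only [tmul, ← TensorProduct.smul_tmul', map_smul]

theorem tmul_smul (c : ℂ) (x : E) (y : F) : tmul x (c • y) = c • tmul x y := by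
  simp only [tmul, TensorProduct.tmul_smul, map_smul]

theorem zero_tmul (y : F) : tmul (0 : E) y = 0 := by
  simp only [tmul, TensorProduct.zero_tmul, map_zero]

theorem tmul_zero (x : E) : tmul x (0 : F) = 0 := by
  simp only [tmul, TensorProduct.tmul_zero, map_zero]

/-- The tensor product `S ⊗ T` of bounded operators. -/
def map (S : E →L[ℂ] G) (T : F →L[ℂ] H) : HilbertTensor E F →L[ℂ] HilbertTensor G H :=
  (TensorProduct.mapL S T).completion

theorem map_coeL (S : E →L[ℂ] G) (T : F →L[ℂ] H) (z : E ⊗[ℂ] F) :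
    map S T (coeL E F z) = coeL G H (TensorProduct.mapL S T z) :=
  ContinuousLinearMap.completion_apply_coe (TensorProduct.mapL S T) z

@[simp]
theorem map_tmul (S : E →L[ℂ] G) (T : F →L[ℂ] H) (x : E) (y : F) :
    map S T (tmul x y) = tmul (S x) (T y) :=
  map_coeL S T (x ⊗ₜ[ℂ] y)

/-- The flip `x ⊗ y ↦ y ⊗ x`. -/
def flip (E F : Type*) [NormedAddCommGroup E] [InnerProductSpace ℂ E]
    [NormedAddCommGroup F] [InnerProductSpace ℂ F] : HilbertTensor E F →L[ℂ] HilbertTensor F E :=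
  ((TensorProduct.commIsometry ℂ E F).toContinuousLinearEquiv :
    E ⊗[ℂ] F →L[ℂ] F ⊗[ℂ] E).completion

@[simp]
theorem flip_tmul (x : E) (y : F) : flip E F (tmul x y) = tmul y x :=
  ContinuousLinearMap.completion_apply_coe
    ((TensorProduct.commIsometry ℂ E F).toContinuousLinearEquiv : E ⊗[ℂ] F →L[ℂ] F ⊗[ℂ] E)
    (x ⊗ₜ[ℂ] y)

theorem map_one_one : map (1 : E →L[ℂ] E) (1 : F →L[ℂ] F) = 1 := ext_tmul fun x y => by simp

theorem map_mul_map (S S' : E →L[ℂ] E) (T T' : F →L[ℂ] F) :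
    map S T * map S' T' = map (S * S') (T * T') := ext_tmul fun x y => by simp

theorem adjoint_eq_of_tmul {S : HilbertTensor E F →L[ℂ] HilbertTensor G H}
    {T : HilbertTensor G H →L[ℂ] HilbertTensor E F}
    (h : ∀ x y x' y', inner ℂ (S (tmul x y)) (tmul x' y') = inner ℂ (tmul x y) (T (tmul x' y'))) :
    ContinuousLinearMap.adjoint S = T := by
  refine ((ContinuousLinearMap.eq_adjoint_iff T S).mpr fun v w => ?_).symm
  have h1 : ∀ x' y', (innerSL ℂ (T (tmul x' y')) : HilbertTensor E F →L[ℂ] ℂ) =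
      innerSL ℂ (tmul x' y') ∘L S := fun x' y' => ext_tmul fun x y => by
    have := congrArg (starRingEnd ℂ) (h x y x' y')
    simpa using this.symm
  have h2 : innerSL ℂ w ∘L T = innerSL ℂ (S w) := ext_tmul fun x' y' => by
    have := congrArg (starRingEnd ℂ) (DFunLike.congr_fun (h1 x' y') w)
    simpa using this
  have := congrArg (starRingEnd ℂ) (DFunLike.congr_fun h2 v)
  simpa using this

theorem star_map [CompleteSpace E] [CompleteSpace F] (S : E →L[ℂ] E) (T : F →L[ℂ] F) :
    star (map S T) = map (star S) (star T) := by
  refine adjoint_eq_of_tmul fun x y x' y' => ?_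
  rw [map_tmul, map_tmul, inner_tmul, inner_tmul, ContinuousLinearMap.star_eq_adjoint,
    ContinuousLinearMap.star_eq_adjoint, ContinuousLinearMap.adjoint_inner_right,
    ContinuousLinearMap.adjoint_inner_right]

theorem tmulL_left_continuous (y : F) : Continuous fun x : E => tmul x y :=
  (coeL E F).continuous.comp (((TensorProduct.mkL ℂ E F).flip y).continuous)

theorem tmulL_right_continuous (x : E) : Continuous fun y : F => tmul x y :=
  (coeL E F).continuous.comp ((TensorProduct.mkL ℂ E F x).continuous)

/-- A closed subspace that contains the elementary tensors is everything. -/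
theorem denseRange_of_tmul {V : Type*} [AddCommGroup V] [Module ℂ V]
    (f : V →ₗ[ℂ] HilbertTensor E F)
    (h : ∀ x y, tmul x y ∈ (LinearMap.range f).topologicalClosure) : DenseRange f := by
  have h1 : ∀ z, z ∈ (LinearMap.range f).topologicalClosure := by
    intro z
    refine denseRange_coeL.induction_on z
      (Submodule.isClosed_topologicalClosure (LinearMap.range f)) fun w => ?_
    induction w using TensorProduct.induction_on with
    | zero => simp
    | tmul x y => exact h x y
    | add a b ha hb => rw [map_add]; exact Submodule.add_mem _ ha hb
  intro z
  have := h1 z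
  rwa [← SetLike.mem_coe, Submodule.topologicalClosure_coe] at this

/-- The embedding of `(E ⊗ F) ⊗ G` with algebraic tensor products. -/
def coeL₁₂ (E F G : Type*) [NormedAddCommGroup E] [InnerProductSpace ℂ E]
    [NormedAddCommGroup F] [InnerProductSpace ℂ F] [NormedAddCommGroup G] [InnerProductSpace ℂ G] :
    (E ⊗[ℂ] F) ⊗[ℂ] G →L[ℂ] HilbertTensor (HilbertTensor E F) G :=
  coeL (HilbertTensor E F) G ∘L (coeL E F).rTensor G

/-- The embedding of `E ⊗ (F ⊗ G)` with algebraic tensor products. -/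
def coeL₂₃ (E F G : Type*) [NormedAddCommGroup E] [InnerProductSpace ℂ E]
    [NormedAddCommGroup F] [InnerProductSpace ℂ F] [NormedAddCommGroup G] [InnerProductSpace ℂ G] :
    E ⊗[ℂ] (F ⊗[ℂ] G) →L[ℂ] HilbertTensor E (HilbertTensor F G) :=
  coeL E (HilbertTensor F G) ∘L (coeL F G).lTensor E

theorem denseRange_coeL₁₂ : DenseRange (coeL₁₂ E F G).toLinearMap := by
  refine denseRange_of_tmul _ fun x y => ?_
  refine denseRange_coeL.induction_on x ?_ fun w => ?_
  · exact (Submodule.isClosed_topologicalClosure _).preimage (tmulL_left_continuous y)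
  · exact Submodule.le_topologicalClosure _ ⟨w ⊗ₜ[ℂ] y, rfl⟩

theorem denseRange_coeL₂₃ : DenseRange (coeL₂₃ E F G).toLinearMap := by
  refine denseRange_of_tmul _ fun x y => ?_
  refine denseRange_coeL.induction_on y ?_ fun w => ?_
  · exact (Submodule.isClosed_topologicalClosure _).preimage (tmulL_right_continuous x)
  · exact Submodule.le_topologicalClosure _ ⟨x ⊗ₜ[ℂ] w, rfl⟩

theorem norm_coeL₁₂ (z : (E ⊗[ℂ] F) ⊗[ℂ] G) : ‖coeL₁₂ E F G z‖ = ‖z‖ :=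
  (norm_coeL _).trans (TensorProduct.norm_map (Completion.toComplₗᵢ (𝕜 := ℂ) (E := E ⊗[ℂ] F))
    (LinearIsometry.id (R := ℂ) (E := G)) z)

theorem norm_coeL₂₃ (z : E ⊗[ℂ] (F ⊗[ℂ] G)) : ‖coeL₂₃ E F G z‖ = ‖z‖ := by
  refine (norm_coeL _).trans ?_
  refine (congrArg norm (ContinuousLinearMap.lTensor_apply (coeL F G) z)).trans ?_
  exact TensorProduct.norm_map (LinearIsometry.id (R := ℂ) (E := E))
    (Completion.toComplₗᵢ (𝕜 := ℂ) (E := F ⊗[ℂ] G)) z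

theorem norm_assoc_aux (z : (E ⊗[ℂ] F) ⊗[ℂ] G) :
    ‖coeL₂₃ E F G ((TensorProduct.assocIsometry ℂ E F G).toLinearEquiv z)‖ =
      ‖coeL₁₂ E F G z‖ := by
  rw [norm_coeL₁₂, norm_coeL₂₃]
  exact (TensorProduct.assocIsometry ℂ E F G).norm_map z

theorem sum_tmul {ι : Type*} (s : Finset ι) (f : ι → E) (y : F) :
    tmul (∑ i ∈ s, f i) y = ∑ i ∈ s, tmul (f i) y := by
  simp only [tmul, TensorProduct.sum_tmul, map_sum]

theorem tmul_sum {ι : Type*} (s : Finset ι) (x : E) (f : ι → F) :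
    tmul x (∑ i ∈ s, f i) = ∑ i ∈ s, tmul x (f i) := by
  simp only [tmul, TensorProduct.tmul_sum, map_sum]

/-- The associator `(x ⊗ y) ⊗ z ↦ x ⊗ (y ⊗ z)`. -/
def assoc (E F G : Type*) [NormedAddCommGroup E] [InnerProductSpace ℂ E]
    [NormedAddCommGroup F] [InnerProductSpace ℂ F] [NormedAddCommGroup G] [InnerProductSpace ℂ G] :
    HilbertTensor (HilbertTensor E F) G ≃ₗᵢ[ℂ] HilbertTensor E (HilbertTensor F G) :=
  (TensorProduct.assocIsometry ℂ E F G).toLinearEquiv.extendOfIsometry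
    (coeL₁₂ E F G).toLinearMap (coeL₂₃ E F G).toLinearMap
    denseRange_coeL₁₂ denseRange_coeL₂₃ norm_assoc_aux

theorem assoc_tmul (x : E) (y : F) (z : G) :
    assoc E F G (tmul (tmul x y) z) = tmul x (tmul y z) :=
  LinearEquiv.extendOfIsometry_eq (f := (TensorProduct.assocIsometry ℂ E F G).toLinearEquiv)
    (e₁ := (coeL₁₂ E F G).toLinearMap)
    (e₂ := (coeL₂₃ E F G).toLinearMap)
    denseRange_coeL₁₂ denseRange_coeL₂₃ norm_assoc_aux ((x ⊗ₜ[ℂ] y) ⊗ₜ[ℂ] z)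

end HilbertTensor

end hilbert

/-! ### Unitary representations of `ℤ/Nℤ` and the braiding -/

/-- A unitary representation of `ℤ/Nℤ` on a Hilbert space. -/
structure ZNRep (N : ℕ) (L : Type*) [NormedAddCommGroup L] [InnerProductSpace ℂ L]
    [CompleteSpace L] where
  /-- The operators of the representation. -/
  π : ZMod N → (L →L[ℂ] L)
  π_zero : π 0 = 1
  π_add : ∀ s t, π (s + t) = π s * π t
  π_mem : ∀ t, π t ∈ unitary (L →L[ℂ] L)

namespace ZNRep

variable {N : ℕ} [NeZero N] {L K : Type*} [NormedAddCommGroup L] [InnerProductSpace ℂ L]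
  [CompleteSpace L] [NormedAddCommGroup K] [InnerProductSpace ℂ K] [CompleteSpace K]

theorem star_π (U : ZNRep N L) (t : ZMod N) : star (U.π t) = U.π (-t) := by
  have h1 : U.π t * U.π (-t) = 1 := by rw [← U.π_add, add_neg_cancel, U.π_zero]
  have h2 := (Unitary.mem_iff.mp (U.π_mem t)).1
  calc star (U.π t) = star (U.π t) * (U.π t * U.π (-t)) := by rw [h1, mul_one]
    _ = U.π (-t) := by rw [← mul_assoc, h2, one_mul]

/-- The tensor product representation. -/
def tensor (U : ZNRep N L) (V : ZNRep N K) : ZNRep N (HilbertTensor L K) where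
  π t := HilbertTensor.map (U.π t) (V.π t)
  π_zero := by rw [U.π_zero, V.π_zero, HilbertTensor.map_one_one]
  π_add s t := by rw [U.π_add, V.π_add, HilbertTensor.map_mul_map]
  π_mem t := by
    rw [Unitary.mem_iff, HilbertTensor.star_map, HilbertTensor.map_mul_map,
      HilbertTensor.map_mul_map, (Unitary.mem_iff.mp (U.π_mem t)).1,
      (Unitary.mem_iff.mp (V.π_mem t)).1, (Unitary.mem_iff.mp (U.π_mem t)).2,
      (Unitary.mem_iff.mp (V.π_mem t)).2, HilbertTensor.map_one_one]
    exact ⟨rfl, rfl⟩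

/-- The orthogonal projection onto the vectors `ξ` of degree `m`, those with
`U_t ξ = ω ^ (t m) ξ` for all `t`. -/
def proj (ω : ℂ) (U : ZNRep N L) (m : ZMod N) : L →L[ℂ] L :=
  (N : ℂ)⁻¹ • ∑ t : ZMod N, chi ω (-(t * m)) • U.π t

/-- The braiding unitary: on a vector `ξ` of degree `m` and a vector `η` of degree `n` it is
`ξ ⊗ η ↦ ω ^ (m n) η ⊗ ξ`, and `V_m η = ω ^ (m n) η`. -/
def braid (ω : ℂ) (U : ZNRep N L) (V : ZNRep N K) : HilbertTensor L K →L[ℂ] HilbertTensor K L :=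
  ∑ m : ZMod N, HilbertTensor.flip L K ∘L HilbertTensor.map (proj ω U m) (V.π m)

/-- The dual braiding unitary: on a vector `ξ` of degree `m` and a vector `η` of degree `n` it is
`η ⊗ ξ ↦ ω ^ (-m n) ξ ⊗ η`. -/
def dualBraid (ω : ℂ) (U : ZNRep N L) (V : ZNRep N K) :
    HilbertTensor K L →L[ℂ] HilbertTensor L K :=
  ∑ m : ZMod N, HilbertTensor.flip K L ∘L HilbertTensor.map (V.π (-m)) (proj ω U m)

variable {ω : ℂ}

theorem proj_apply_of_degree (hω : IsPrimitiveRoot ω N) (U : ZNRep N L) {ξ : L} {n : ZMod N}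
    (h : ∀ t, U.π t ξ = chi ω (t * n) • ξ) (m : ZMod N) :
    proj ω U m ξ = if m = n then ξ else 0 := by
  have hN : (N : ℂ) ≠ 0 := Nat.cast_ne_zero.mpr (NeZero.ne N)
  have h1 : proj ω U m ξ = ((N : ℂ)⁻¹ * ∑ t : ZMod N, chi ω (t * (n - m))) • ξ := by
    simp only [proj, smul_apply, sum_apply, h, smul_smul,
      ← chi_add hω, mul_smul, Finset.sum_smul]
    refine congrArg _ (Finset.sum_congr rfl fun t _ => ?_)
    congr 2
    ring
  rw [h1, sum_chi hω]
  by_cases hmn : m = n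
  · simp [hmn, hN]
  · simp [hmn, sub_eq_zero, Ne.symm hmn]

theorem degree_proj (hω : IsPrimitiveRoot ω N) (U : ZNRep N L) (ξ : L) (m t : ZMod N) :
    U.π t (proj ω U m ξ) = chi ω (t * m) • proj ω U m ξ := by
  simp only [proj, smul_apply, sum_apply, map_smul, map_sum]
  rw [smul_comm (chi ω (t * m))]
  refine congrArg (fun z : L => (N : ℂ)⁻¹ • z) ?_
  rw [Finset.smul_sum]
  refine Fintype.sum_equiv (Equiv.addLeft t) _ _ fun s => ?_
  rw [Equiv.coe_addLeft, U.π_add, smul_smul, ← chi_add hω, mul_apply_eq_comp]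
  congr 2
  ring

theorem sum_proj (hω : IsPrimitiveRoot ω N) (U : ZNRep N L) (ξ : L) :
    ∑ m, proj ω U m ξ = ξ := by
  have hN : (N : ℂ) ≠ 0 := Nat.cast_ne_zero.mpr (NeZero.ne N)
  simp only [proj, smul_apply, sum_apply]
  rw [← Finset.smul_sum, Finset.sum_comm]
  have h1 : ∀ t : ZMod N, ∑ m : ZMod N, chi ω (-(t * m)) • U.π t ξ =
      if t = 0 then (N : ℂ) • ξ else 0 := by
    intro t
    rw [← Finset.sum_smul]
    have h2 : ∑ m : ZMod N, chi ω (-(t * m)) = ∑ m : ZMod N, chi ω (m * (-t)) :=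
      Finset.sum_congr rfl fun m _ => by congr 1; ring
    rw [h2, sum_chi hω]
    by_cases ht : t = 0
    · simp [ht, U.π_zero]
    · simp [ht]
  rw [Finset.sum_congr rfl fun t _ => h1 t]
  simp [smul_smul, hN]

theorem star_proj (hω : IsPrimitiveRoot ω N) (U : ZNRep N L) (m : ZMod N) :
    star (proj ω U m) = proj ω U m := by
  simp only [proj, star_smul, star_sum, star_chi hω, star_π, star_inv₀, star_natCast]
  refine congrArg _ (Fintype.sum_equiv (Equiv.neg _) _ _ fun s => ?_)
  rw [Equiv.neg_apply]
  congr 2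
  ring

theorem braid_apply (U : ZNRep N L) (V : ZNRep N K) (ξ : L) (η : K) :
    braid ω U V (HilbertTensor.tmul ξ η) =
      ∑ m, HilbertTensor.tmul (V.π m η) (proj ω U m ξ) := by
  simp [braid]

theorem dualBraid_apply (U : ZNRep N L) (V : ZNRep N K) (ξ : L) (η : K) :
    dualBraid ω U V (HilbertTensor.tmul η ξ) =
      ∑ m, HilbertTensor.tmul (proj ω U m ξ) (V.π (-m) η) := by
  simp [dualBraid]

theorem braid_tmul (hω : IsPrimitiveRoot ω N) (U : ZNRep N L) (V : ZNRep N K) {ξ : L} {η : K}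
    {m n : ZMod N} (hξ : ∀ t, U.π t ξ = chi ω (t * m) • ξ)
    (hη : ∀ t, V.π t η = chi ω (t * n) • η) :
    braid ω U V (HilbertTensor.tmul ξ η) = chi ω (m * n) • HilbertTensor.tmul η ξ := by
  rw [braid_apply, Finset.sum_eq_single m, hη, proj_apply_of_degree hω U hξ, if_pos rfl,
    HilbertTensor.smul_tmul]
  · intro k _ hk
    rw [proj_apply_of_degree hω U hξ, if_neg hk, HilbertTensor.tmul_zero]
  · simp

theorem dualBraid_tmul (hω : IsPrimitiveRoot ω N) (U : ZNRep N L) (V : ZNRep N K) {ξ : L} {η : K}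
    {m n : ZMod N} (hξ : ∀ t, U.π t ξ = chi ω (t * m) • ξ)
    (hη : ∀ t, V.π t η = chi ω (t * n) • η) :
    dualBraid ω U V (HilbertTensor.tmul η ξ) = chi ω (-(m * n)) • HilbertTensor.tmul ξ η := by
  rw [dualBraid_apply, Finset.sum_eq_single m, hη, proj_apply_of_degree hω U hξ, if_pos rfl,
    HilbertTensor.tmul_smul, neg_mul]
  · intro k _ hk
    rw [proj_apply_of_degree hω U hξ, if_neg hk, HilbertTensor.zero_tmul]
  · simp

/-- Bounded operators on `L ⊗ K` that agree on tensors of homogeneous vectors are equal. -/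
theorem ext_degree (hω : IsPrimitiveRoot ω N) (U : ZNRep N L) (V : ZNRep N K)
    {X : Type*} [NormedAddCommGroup X] [NormedSpace ℂ X] {S T : HilbertTensor L K →L[ℂ] X}
    (h : ∀ (ξ : L) (η : K) (m n : ZMod N), (∀ t, U.π t ξ = chi ω (t * m) • ξ) →
      (∀ t, V.π t η = chi ω (t * n) • η) →
      S (HilbertTensor.tmul ξ η) = T (HilbertTensor.tmul ξ η)) : S = T := by
  refine HilbertTensor.ext_tmul fun x y => ?_
  rw [← sum_proj hω U x, ← sum_proj hω V y]
  simp only [HilbertTensor.sum_tmul, HilbertTensor.tmul_sum, map_sum]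
  exact Finset.sum_congr rfl fun m _ => Finset.sum_congr rfl fun n _ =>
    h _ _ _ _ (degree_proj hω U x _) (degree_proj hω V y _)

theorem dualBraid_comp_braid (hω : IsPrimitiveRoot ω N) (U : ZNRep N L) (V : ZNRep N K) :
    dualBraid ω U V ∘L braid ω U V = 1 := by
  refine ext_degree hω U V fun ξ η m n hξ hη => ?_
  rw [ContinuousLinearMap.comp_apply, braid_tmul hω U V hξ hη, map_smul,
    dualBraid_tmul hω U V hξ hη, smul_smul, ← chi_add hω, add_neg_cancel, chi_zero, one_smul,
    one_apply_eq_self]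

theorem braid_comp_dualBraid (hω : IsPrimitiveRoot ω N) (U : ZNRep N L) (V : ZNRep N K) :
    braid ω U V ∘L dualBraid ω U V = 1 := by
  refine ext_degree hω V U fun η ξ n m hη hξ => ?_
  rw [ContinuousLinearMap.comp_apply, dualBraid_tmul hω U V hξ hη, map_smul,
    braid_tmul hω U V hξ hη, smul_smul, ← chi_add hω, neg_add_cancel, chi_zero, one_smul,
    one_apply_eq_self]

theorem adjoint_braid (hω : IsPrimitiveRoot ω N) (U : ZNRep N L) (V : ZNRep N K) :
    ContinuousLinearMap.adjoint (braid ω U V) = dualBraid ω U V := by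
  refine HilbertTensor.adjoint_eq_of_tmul fun ξ η η' ξ' => ?_
  rw [braid_apply, dualBraid_apply, sum_inner, inner_sum]
  refine Finset.sum_congr rfl fun m _ => ?_
  have hP : inner ℂ (proj ω U m ξ) ξ' = inner ℂ ξ (proj ω U m ξ') := by
    conv_rhs => rw [← star_proj hω U m, ContinuousLinearMap.star_eq_adjoint,
      ContinuousLinearMap.adjoint_inner_right]
  have hV : inner ℂ (V.π m η) η' = inner ℂ η (V.π (-m) η') := by
    rw [← star_π, ContinuousLinearMap.star_eq_adjoint, ContinuousLinearMap.adjoint_inner_right]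
  rw [HilbertTensor.inner_tmul, HilbertTensor.inner_tmul, hP, hV, mul_comm]

theorem braid_comp_tensor (hω : IsPrimitiveRoot ω N) (U : ZNRep N L) (V : ZNRep N K) (t : ZMod N) :
    braid ω U V ∘L (U.tensor V).π t = (V.tensor U).π t ∘L braid ω U V := by
  refine ext_degree hω U V fun ξ η m n hξ hη => ?_
  simp only [ContinuousLinearMap.comp_apply, tensor, HilbertTensor.map_tmul, hξ, hη,
    HilbertTensor.smul_tmul, HilbertTensor.tmul_smul, map_smul, braid_tmul hω U V hξ hη,
    smul_smul]
  congr 1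
  ring

theorem tensor_comp_dualBraid (hω : IsPrimitiveRoot ω N) (U : ZNRep N L) (V : ZNRep N K)
    (t : ZMod N) :
    (U.tensor V).π t ∘L dualBraid ω U V = dualBraid ω U V ∘L (V.tensor U).π t := by
  refine ext_degree hω V U fun η ξ n m hη hξ => ?_
  simp only [ContinuousLinearMap.comp_apply, tensor, HilbertTensor.map_tmul, hξ, hη,
    HilbertTensor.smul_tmul, HilbertTensor.tmul_smul, map_smul, dualBraid_tmul hω U V hξ hη,
    smul_smul]
  congr 1
  ring

/-- The operator `x ⊗ id`. -/
def leg₁ (K : Type*) [NormedAddCommGroup K] [InnerProductSpace ℂ K]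
    (x : L →L[ℂ] L) : HilbertTensor L K →L[ℂ] HilbertTensor L K :=
  HilbertTensor.map x 1

/-- The operator `y ⊗ id` on `K ⊗ L`, conjugated by the braiding. -/
def leg₂ (ω : ℂ) (U : ZNRep N L) (V : ZNRep N K) (y : K →L[ℂ] K) :
    HilbertTensor L K →L[ℂ] HilbertTensor L K :=
  dualBraid ω U V ∘L HilbertTensor.map y 1 ∘L braid ω U V

/-- `x ↦ x ⊗ id` as a unital `*`-homomorphism. -/
def leg₁Hom (L K : Type*) [NormedAddCommGroup L] [InnerProductSpace ℂ L] [CompleteSpace L]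
    [NormedAddCommGroup K] [InnerProductSpace ℂ K] [CompleteSpace K] :
    (L →L[ℂ] L) →⋆ₐ[ℂ] (HilbertTensor L K →L[ℂ] HilbertTensor L K) where
  toFun x := leg₁ K x
  map_one' := HilbertTensor.map_one_one
  map_mul' x y := by rw [leg₁, leg₁, leg₁, HilbertTensor.map_mul_map, mul_one]
  map_zero' := HilbertTensor.ext_tmul fun x y => by simp [leg₁, HilbertTensor.zero_tmul]
  map_add' x y := HilbertTensor.ext_tmul fun x y => by simp [leg₁, HilbertTensor.add_tmul]
  commutes' c := HilbertTensor.ext_tmul fun x y => by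
    simp [leg₁, HilbertTensor.smul_tmul, Algebra.algebraMap_eq_smul_one]
  map_star' x := by rw [leg₁, leg₁, HilbertTensor.star_map, star_one]

theorem leg₂_eq (U : ZNRep N L) (V : ZNRep N K) (y : K →L[ℂ] K) :
    leg₂ ω U V y = dualBraid ω U V ∘L leg₁Hom K L y ∘L braid ω U V := rfl

/-- `y ↦ c (y ⊗ id) c*` as a unital `*`-homomorphism. -/
def leg₂Hom (hω : IsPrimitiveRoot ω N) (U : ZNRep N L) (V : ZNRep N K) :
    (K →L[ℂ] K) →⋆ₐ[ℂ] (HilbertTensor L K →L[ℂ] HilbertTensor L K) where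
  toFun y := leg₂ ω U V y
  map_one' := by
    rw [leg₂_eq, map_one, ContinuousLinearMap.one_def, ContinuousLinearMap.id_comp,
      dualBraid_comp_braid hω]
  map_mul' x y := by
    ext z
    have h := fun w => DFunLike.congr_fun (braid_comp_dualBraid hω U V) w
    simp only [ContinuousLinearMap.comp_apply, one_apply_eq_self] at h
    simp [leg₂_eq, h]
  map_zero' := by rw [leg₂_eq, _root_.map_zero]; simp
  map_add' x y := by
    rw [leg₂_eq, leg₂_eq, leg₂_eq, map_add, ContinuousLinearMap.add_comp,
      ContinuousLinearMap.comp_add]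
  commutes' c := by
    ext z
    have h := fun w => DFunLike.congr_fun (dualBraid_comp_braid hω U V) w
    simp only [ContinuousLinearMap.comp_apply, one_apply_eq_self] at h
    rw [leg₂_eq, AlgHomClass.commutes]
    simp [Algebra.algebraMap_eq_smul_one, h]
  map_star' x := by
    have h1 := adjoint_braid hω U V
    have h2 : ContinuousLinearMap.adjoint (dualBraid ω U V) = braid ω U V := by
      rw [← h1, ContinuousLinearMap.adjoint_adjoint]
    have h3 : ∀ T : HilbertTensor K L →L[ℂ] HilbertTensor K L,
        star (dualBraid ω U V ∘L T ∘L braid ω U V) = dualBraid ω U V ∘L star T ∘L braid ω U V := by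
      intro T
      rw [ContinuousLinearMap.star_eq_adjoint, ContinuousLinearMap.star_eq_adjoint,
        ContinuousLinearMap.adjoint_comp, ContinuousLinearMap.adjoint_comp, h1, h2,
        ContinuousLinearMap.comp_assoc]
    rw [leg₂_eq, leg₂_eq, h3, map_star]

/-- Conjugation by the representation. -/
def conj (U : ZNRep N L) (t : ZMod N) : (L →L[ℂ] L) →⋆ₐ[ℂ] (L →L[ℂ] L) :=
  (Unitary.conjStarAlgAut ℂ (L →L[ℂ] L) ⟨U.π t, U.π_mem t⟩).toStarAlgHom

theorem conj_apply (U : ZNRep N L) (t : ZMod N) (x : L →L[ℂ] L) :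
    U.conj t x = U.π t * x * star (U.π t) := rfl

theorem conj_leg₁ (U : ZNRep N L) (V : ZNRep N K) (t : ZMod N) (x : L →L[ℂ] L) :
    (U.tensor V).conj t (leg₁ K x) = leg₁ K (U.conj t x) := by
  have h : U.π t * x * star (U.π t) = U.π t * (x * star (U.π t)) := mul_assoc _ _ _
  rw [conj_apply, conj_apply, leg₁, leg₁, tensor, HilbertTensor.star_map,
    HilbertTensor.map_mul_map, HilbertTensor.map_mul_map, mul_one,
    (Unitary.mem_iff.mp (V.π_mem t)).2]

theorem conj_leg₂ (hω : IsPrimitiveRoot ω N) (U : ZNRep N L) (V : ZNRep N K) (t : ZMod N)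
    (y : K →L[ℂ] K) :
    (U.tensor V).conj t (leg₂ ω U V y) = leg₂ ω U V (V.conj t y) := by
  have hl := DFunLike.congr_fun (conj_leg₁ V U t y)
  have hb := DFunLike.congr_fun (braid_comp_tensor hω U V (-t))
  have hd := DFunLike.congr_fun (tensor_comp_dualBraid hω U V t)
  rw [conj_apply, star_π] at hl
  simp only [ContinuousLinearMap.comp_apply, mul_apply_eq_comp] at hl hb hd
  refine ContinuousLinearMap.ext fun z => ?_
  rw [conj_apply, star_π, leg₂, leg₂]
  simp only [ContinuousLinearMap.comp_apply, mul_apply_eq_comp]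
  rw [hb, hd]
  exact congrArg _ (hl _)

end ZNRep

/-! ### Braided tensor products -/

/-- A faithful equivariant representation of a `C*`-algebra with an action of `ℤ/Nℤ` on a Hilbert
space with a unitary representation of `ℤ/Nℤ`. -/
structure EquivRep {N : ℕ} [NeZero N] {X : Type*} [CStarAlgebra X] (α : ZNAction N X) (L : Type*)
    [NormedAddCommGroup L] [InnerProductSpace ℂ L] [CompleteSpace L] where
  /-- The unitary representation. -/
  U : ZNRep N L
  /-- The representation of the algebra. -/
  hom : X →⋆ₐ[ℂ] (L →L[ℂ] L)
  injective : Function.Injective hom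
  covariant : ∀ t x, hom (α.ρ x t) = U.π t * hom x * star (U.π t)

section braided

variable {N : ℕ} [NeZero N] {ω : ℂ} {X Y : Type*} [CStarAlgebra X] [CStarAlgebra Y]
  {α : ZNAction N X} {β : ZNAction N Y}
  {L K : Type*} [NormedAddCommGroup L] [InnerProductSpace ℂ L] [CompleteSpace L]
  [NormedAddCommGroup K] [InnerProductSpace ℂ K] [CompleteSpace K]

/-- The braided tensor product `X ⊠ Y`: the `C*`-algebra of operators on `L ⊗ K` generated by the
products `j₁(x) j₂(y)`. -/
def Braided (ω : ℂ) (θ : EquivRep α L) (κ : EquivRep β K) :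
    StarSubalgebra ℂ (HilbertTensor L K →L[ℂ] HilbertTensor L K) :=
  (StarAlgebra.adjoin ℂ {T | ∃ x y,
    T = ZNRep.leg₁ K (θ.hom x) * ZNRep.leg₂ ω θ.U κ.U (κ.hom y)}).topologicalClosure

namespace Braided

instance (θ : EquivRep α L) (κ : EquivRep β K) :
    IsClosed (Braided ω θ κ : Set (HilbertTensor L K →L[ℂ] HilbertTensor L K)) :=
  StarSubalgebra.isClosed_topologicalClosure _

theorem mul_mem (θ : EquivRep α L) (κ : EquivRep β K) (x : X) (y : Y) :
    ZNRep.leg₁ K (θ.hom x) * ZNRep.leg₂ ω θ.U κ.U (κ.hom y) ∈ Braided ω θ κ :=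
  StarSubalgebra.le_topologicalClosure _ (StarAlgebra.subset_adjoin ℂ _ ⟨x, y, rfl⟩)

/-- The embedding `j₁ : X → X ⊠ Y`. -/
def j₁ (hω : IsPrimitiveRoot ω N) (θ : EquivRep α L) (κ : EquivRep β K) :
    X →⋆ₐ[ℂ] Braided ω θ κ :=
  ((ZNRep.leg₁Hom L K).comp θ.hom).codRestrict _ fun x => by
    have := mul_mem (ω := ω) θ κ x 1
    have h1 : ZNRep.leg₂ ω θ.U κ.U (κ.hom 1) = 1 := by
      rw [map_one]; exact map_one (ZNRep.leg₂Hom hω θ.U κ.U)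
    rwa [h1, mul_one] at this

/-- The embedding `j₂ : Y → X ⊠ Y`. -/
def j₂ (hω : IsPrimitiveRoot ω N) (θ : EquivRep α L) (κ : EquivRep β K) :
    Y →⋆ₐ[ℂ] Braided ω θ κ :=
  ((ZNRep.leg₂Hom hω θ.U κ.U).comp κ.hom).codRestrict _ fun y => by
    have := mul_mem (ω := ω) θ κ 1 y
    have h1 : ZNRep.leg₁ K (θ.hom 1) = 1 := by
      rw [map_one]; exact map_one (ZNRep.leg₁Hom L K)
    rwa [h1, one_mul] at this

theorem conj_mem (hω : IsPrimitiveRoot ω N) (θ : EquivRep α L) (κ : EquivRep β K)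
    (t : ZMod N) {T : HilbertTensor L K →L[ℂ] HilbertTensor L K}
    (hT : T ∈ Braided ω θ κ) : (θ.U.tensor κ.U).conj t T ∈ Braided ω θ κ := by
  have hc : Continuous ((θ.U.tensor κ.U).conj t) := continuous_hom _
  have h1 : ∀ S ∈ StarAlgebra.adjoin ℂ {T | ∃ x y,
      T = ZNRep.leg₁ K (θ.hom x) * ZNRep.leg₂ ω θ.U κ.U (κ.hom y)},
      (θ.U.tensor κ.U).conj t S ∈ Braided ω θ κ := by
    intro S hS
    induction hS using StarAlgebra.adjoin_induction with
    | mem S hS =>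
      obtain ⟨x, y, rfl⟩ := hS
      have h2 := ZNRep.conj_leg₁ θ.U κ.U t (θ.hom x)
      have h3 := ZNRep.conj_leg₂ hω θ.U κ.U t (κ.hom y)
      rw [ZNRep.conj_apply θ.U, ← θ.covariant] at h2
      rw [ZNRep.conj_apply κ.U, ← κ.covariant] at h3
      rw [map_mul, h2, h3]
      exact mul_mem θ κ _ _
    | algebraMap c => rw [AlgHomClass.commutes]; exact algebraMap_mem _ c
    | add S T _ _ hS hT => rw [map_add]; exact add_mem hS hT
    | mul S T _ _ hS hT => rw [map_mul]; exact MulMemClass.mul_mem hS hT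
    | star S _ hS => rw [map_star]; exact star_mem hS
  have h4 := map_mem_closure hc hT h1
  have h5 : IsClosed (Braided ω θ κ : Set (HilbertTensor L K →L[ℂ] HilbertTensor L K)) :=
    inferInstance
  rwa [h5.closure_eq] at h4

/-- The coaction on `X ⊠ Y`, given by conjugation with the tensor product representation; it is the
coaction for which `j₁` and `j₂` are equivariant. -/
def action (hω : IsPrimitiveRoot ω N) (θ : EquivRep α L) (κ : EquivRep β K) :
    ZNAction N (Braided ω θ κ) :=
  ZNAction.ofFamily
    (fun t => (((θ.U.tensor κ.U).conj t).comp (Braided ω θ κ).subtype).codRestrict _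
      fun T => conj_mem hω θ κ t T.2)
    (fun T => by
      refine Subtype.ext ?_
      change (θ.U.tensor κ.U).conj 0 T.1 = T.1
      rw [ZNRep.conj_apply, ZNRep.π_zero, star_one, one_mul, mul_one])
    (fun s t T => by
      refine Subtype.ext ?_
      change (θ.U.tensor κ.U).conj s ((θ.U.tensor κ.U).conj t T.1) =
        (θ.U.tensor κ.U).conj (s + t) T.1
      rw [ZNRep.conj_apply, ZNRep.conj_apply, ZNRep.conj_apply, ZNRep.π_add, star_mul]
      simp only [mul_assoc])

theorem j₁_equivariant (hω : IsPrimitiveRoot ω N) (θ : EquivRep α L) (κ : EquivRep β K) :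
    ZNAction.IsEquivariant α (action hω θ κ) (j₁ hω θ κ) := by
  intro x t
  refine Subtype.ext ?_
  change (θ.U.tensor κ.U).conj t (ZNRep.leg₁ K (θ.hom x)) = ZNRep.leg₁ K (θ.hom (α.ρ x t))
  rw [ZNRep.conj_leg₁, ZNRep.conj_apply, θ.covariant]

theorem j₂_equivariant (hω : IsPrimitiveRoot ω N) (θ : EquivRep α L) (κ : EquivRep β K) :
    ZNAction.IsEquivariant β (action hω θ κ) (j₂ hω θ κ) := by
  intro y t
  refine Subtype.ext ?_
  change (θ.U.tensor κ.U).conj t (ZNRep.leg₂ ω θ.U κ.U (κ.hom y)) =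
    ZNRep.leg₂ ω θ.U κ.U (κ.hom (β.ρ y t))
  rw [ZNRep.conj_leg₂ hω, ZNRep.conj_apply, κ.covariant]

/-- The inclusion of `X ⊠ Y` into the bounded operators on `L ⊗ K` as a faithful equivariant
representation. -/
def rep (hω : IsPrimitiveRoot ω N) (θ : EquivRep α L) (κ : EquivRep β K) :
    EquivRep (action hω θ κ) (HilbertTensor L K) where
  U := θ.U.tensor κ.U
  hom := (Braided ω θ κ).subtype
  injective := Subtype.val_injective
  covariant _ _ := rfl

/-- The map `Φ : X ⊠ Y → X' ⊠ Y'` is the braided tensor product `φ ⊠ ψ` of the morphisms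
`φ : X → X'` and `ψ : Y → Y'`. -/
structure IsTensorMap (hω : IsPrimitiveRoot ω N) (θ : EquivRep α L) (κ : EquivRep β K)
    {X' Y' : Type*} [CStarAlgebra X'] [CStarAlgebra Y']
    {α' : ZNAction N X'} {β' : ZNAction N Y'}
    {L' K' : Type*} [NormedAddCommGroup L'] [InnerProductSpace ℂ L'] [CompleteSpace L']
    [NormedAddCommGroup K'] [InnerProductSpace ℂ K'] [CompleteSpace K']
    (θ' : EquivRep α' L') (κ' : EquivRep β' K') (φ : X →⋆ₐ[ℂ] X') (ψ : Y →⋆ₐ[ℂ] Y')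
    (Φ : Braided ω θ κ →⋆ₐ[ℂ] Braided ω θ' κ') : Prop where
  equivariant : ZNAction.IsEquivariant (action hω θ κ) (action hω θ' κ') Φ
  apply_mul : ∀ x y,
    Φ (j₁ hω θ κ x * j₂ hω θ κ y) = j₁ hω θ' κ' (φ x) * j₂ hω θ' κ' (ψ y)

end Braided

/-- `(X, α, Δ)` is an anyonic compact quantum group; the braided tensor products are formed with
the faithful equivariant representation `θ` of `X`. -/
structure IsAnyonicCQG (hω : IsPrimitiveRoot ω N) (θ : EquivRep α L)
    (Δ : X →⋆ₐ[ℂ] Braided ω θ θ) : Prop where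
  equivariant : ZNAction.IsEquivariant α (Braided.action hω θ θ) Δ
  /-- `(Δ ⊠ id) ∘ Δ = (id ⊠ Δ) ∘ Δ`, where `(X ⊠ X) ⊠ X` and `X ⊠ (X ⊠ X)` are identified by the
  associator of the Hilbert space `L`. -/
  coassoc : ∃ (Φ : Braided ω θ θ →⋆ₐ[ℂ] Braided ω (Braided.rep hω θ θ) θ)
    (Ψ : Braided ω θ θ →⋆ₐ[ℂ] Braided ω θ (Braided.rep hω θ θ)),
    Braided.IsTensorMap hω θ θ (Braided.rep hω θ θ) θ Δ (StarAlgHom.id ℂ X) Φ ∧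
    Braided.IsTensorMap hω θ θ θ (Braided.rep hω θ θ) (StarAlgHom.id ℂ X) Δ Ψ ∧
    ∀ x ξ, HilbertTensor.assoc L L L ((Φ (Δ x)).1 ξ) =
      (Ψ (Δ x)).1 (HilbertTensor.assoc L L L ξ)
  /-- `Δ(X) (1 ⊠ X) = X ⊠ X`. -/
  bisimplifiable_right : (Submodule.span ℂ {T | ∃ x y,
    T = Δ x * Braided.j₂ hω θ θ y}).topologicalClosure = ⊤
  /-- `Δ(X) (X ⊠ 1) = X ⊠ X`. -/
  bisimplifiable_left : (Submodule.span ℂ {T | ∃ x y,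
    T = Δ x * Braided.j₁ hω θ θ y}).topologicalClosure = ⊤

end braided

end

/-!
The two legs of `X ⊠ Y` commute up to phases, `j₂(y) j₁(x) = ω ^ (-m n) j₁(x) j₂(y)` for `x` of
degree `m` and `y` of degree `n`. The twist `ω ^ (-i (j - i))` in `ū_R` absorbs these phases, so the
twisted conjugate of `v = j₁(u) j₂(u)` is `j₁(ū_R) j₂(ū_R)`. Both matrices are therefore unitary and
the universal property yields `Δ`. Coassociativity is a computation on generators, once the
associator of Hilbert spaces is seen to carry the three legs of `(X ⊠ X) ⊠ X` to those of
`X ⊠ (X ⊠ X)`.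

From `Δ(u) = j₁(u) j₂(u)` and unitarity, `j₁(u) = Δ(u) j₂(u)*`, and likewise for `ū_R`. Hence the
span of `Δ(X) j₂(X)` contains `j₁` of the generators and their adjoints; as these commute with
`j₂(X)` up to the action, its closure is stable under right multiplication by all of `j₁(X)`. The
span of `Δ(X) j₁(X)` is treated in the same way, through `j₂(u)* = Δ(u)* j₁(u)`.

The maps `φ ⊠ id` and `id ⊠ ψ` exist because an operator on `L ⊗ K` is determined by its slices, and
the slices of elements of `X ⊠ Y` lie in the faithfully represented algebra `X` or `Y`. A faithful
representation `σ` becomes equivariant on a sum of `N` copies of its space, by letting `x` act on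
the copy of index `s` as `σ(ρ_s(x))`.
-/

noncomputable section

open scoped TensorProduct InnerProductSpace

universe u

/-! ### Faithful equivariant representations -/

section GelfandNaimark

open scoped ComplexOrder

theorem exists_positiveLinearMap_ne_zero {A : Type*} [CStarAlgebra A] [PartialOrder A]
    [StarOrderedRing A] {a : A} (ha : 0 ≤ a) (ha' : a ≠ 0) : ∃ f : A →ₚ[ℂ] ℂ, f a ≠ 0 := by
  have hna : -a ∉ ProperCone.positive ℝ A := fun h =>
    ha' (le_antisymm (neg_nonneg.mp (ProperCone.mem_positive.mp h)) ha)
  obtain ⟨f, hf, hfa⟩ := ProperCone.hyperplane_separation_point _ hna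
  let g : Module.Dual ℝ A := f.toLinearMap ∘ₗ (selfAdjoint.submodule ℝ A).subtype ∘ₗ realPart
  have hg : ∀ x : A, IsSelfAdjoint x → (g.extendRCLike : Module.Dual ℂ A) x = (f x : ℂ) := by
    intro x hx
    have hre : g x = f x := by
      change f (realPart x : A) = f x
      rw [hx.coe_realPart]
    have him : g ((RCLike.I : ℂ) • x) = 0 := by
      change f (realPart (Complex.I • x) : A) = 0
      simp [realPart_I_smul, hx.imaginaryPart]
    rw [Module.Dual.extendRCLike_apply, hre, him]
    simp
  refine ⟨PositiveLinearMap.mk₀ g.extendRCLike fun x hx => ?_, ?_⟩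
  · rw [hg x (.of_nonneg hx)]
    exact Complex.zero_le_real.mpr (hf x (ProperCone.mem_positive.mpr hx))
  · change (g.extendRCLike : Module.Dual ℂ A) a ≠ 0
    rw [map_neg, neg_lt_zero] at hfa
    rw [hg a (.of_nonneg ha)]
    exact_mod_cast hfa.ne'

theorem gnsStarAlgHom_ne_zero {A : Type*} [CStarAlgebra A] [PartialOrder A] [StarOrderedRing A]
    (f : A →ₚ[ℂ] ℂ) {a : A} (ha : f (star a * a) ≠ 0) : f.gnsStarAlgHom a ≠ 0 := by
  intro h
  have hcyclic : ((f.leftMulMapPreGNS a (f.toPreGNS 1) : f.PreGNS) : f.GNS) = 0 := by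
    rw [← PositiveLinearMap.gnsNonUnitalStarAlgHom_apply_coe]
    exact DFunLike.congr_fun h (f.toPreGNS 1 : f.GNS)
  have hnorm : ‖f.leftMulMapPreGNS a (f.toPreGNS 1)‖ = 0 := by
    rw [← UniformSpace.Completion.norm_coe, hcyclic, norm_zero]
  have hsq := f.preGNS_norm_sq (f.leftMulMapPreGNS a (f.toPreGNS 1))
  rw [hnorm] at hsq
  exact ha (by simpa using hsq.symm)

end GelfandNaimark

section DirectSum

variable {X ι : Type*} [CStarAlgebra X] {H : ι → Type*} [∀ i, NormedAddCommGroup (H i)]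
  [∀ i, InnerProductSpace ℂ (H i)] [∀ i, CompleteSpace (H i)]

/-- The direct sum of a family of representations of a `C*`-algebra, on the Hilbert sum. -/
def directSumHom (σ : ∀ i, X →⋆ₐ[ℂ] (H i →L[ℂ] H i)) : X →⋆ₐ[ℂ] (lp H 2 →L[ℂ] lp H 2) where
  toFun x := lp.mapCLM 2 (fun i => σ i x) (norm_nonneg x)
    fun i => NonUnitalStarAlgHom.norm_apply_le (σ i) x
  map_one' := by ext; simp
  map_mul' x y := by ext; simp
  map_zero' := by ext; simp
  map_add' x y := by ext; simp [add_apply]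
  commutes' c := by ext; simp [Algebra.algebraMap_eq_smul_one]
  map_star' x := by
    refine (ContinuousLinearMap.eq_adjoint_iff _ _).mpr fun f g => ?_
    simp only [lp.inner_eq_tsum, lp.mapCLM_apply_coe, map_star,
      ContinuousLinearMap.star_eq_adjoint, ContinuousLinearMap.adjoint_inner_left]

@[simp]
theorem directSumHom_apply (σ : ∀ i, X →⋆ₐ[ℂ] (H i →L[ℂ] H i)) (x : X) (f : lp H 2) (i : ι) :
    directSumHom σ x f i = σ i x (f i) := rfl

theorem directSumHom_injective {σ : ∀ i, X →⋆ₐ[ℂ] (H i →L[ℂ] H i)}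
    (h : ∀ x, (∀ i, σ i x = 0) → x = 0) : Function.Injective (directSumHom σ) := by
  classical
  refine (injective_iff_map_eq_zero _).mpr fun x hx => h x fun i =>
    ContinuousLinearMap.ext fun v => ?_
  rw [← lp.single_apply_self (E := H) 2 i v, ← directSumHom_apply, hx]
  rfl

end DirectSum

open scoped ComplexOrder in
theorem exists_injective_starAlgHom (X : Type u) [CStarAlgebra X] :
    ∃ (H : Type u) (_ : NormedAddCommGroup H) (_ : InnerProductSpace ℂ H) (_ : CompleteSpace H)
      (σ : X →⋆ₐ[ℂ] (H →L[ℂ] H)), Function.Injective σ := by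
  let _ := CStarAlgebra.spectralOrder X
  have _ := CStarAlgebra.spectralOrderedRing X
  have hsep : ∀ b : {b : X // b ≠ 0}, ∃ f : X →ₚ[ℂ] ℂ, f (star b.1 * b.1) ≠ 0 := fun b =>
    exists_positiveLinearMap_ne_zero (star_mul_self_nonneg b.1)
      (CStarRing.star_mul_self_eq_zero_iff b.1 |>.not.mpr b.2)
  choose f hf using hsep
  refine ⟨lp (fun b => (f b).GNS) 2, inferInstance, inferInstance, inferInstance,
    directSumHom fun b => (f b).gnsStarAlgHom, directSumHom_injective fun x hx => ?_⟩
  by_contra hne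
  exact gnsStarAlgHom_ne_zero _ (hf ⟨x, hne⟩) (hx ⟨x, hne⟩)

namespace ZNAction

variable {N : ℕ} [NeZero N] {X : Type*} [CStarAlgebra X]

/-- The endomorphism `ρ_t` by which `t ∈ ℤ/Nℤ` acts, as a unital `*`-homomorphism. -/
def ρAt (α : ZNAction N X) (t : ZMod N) : X →⋆ₐ[ℂ] X :=
  (Pi.evalStarAlgHom ℂ (fun _ : ZMod N => X) t).comp α.ρ

@[simp]
theorem ρAt_apply (α : ZNAction N X) (t : ZMod N) (x : X) : α.ρAt t x = α.ρ x t := rfl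

-- `ρ_0` is idempotent by coassociativity, and has dense range by the density condition.
@[simp]
theorem ρ_zero (α : ZNAction N X) (x : X) : α.ρ x 0 = x := by
  let W : Submodule ℂ (ZMod N → X) :=
    LinearMap.eqLocus ((α.ρAt 0).toAlgHom.toLinearMap ∘ₗ LinearMap.proj 0) (LinearMap.proj 0)
  have hW : IsClosed (W : Set (ZMod N → X)) :=
    isClosed_eq ((continuous_hom (α.ρAt 0)).comp (continuous_apply 0)) (continuous_apply 0)
  have hmem : (fun _ => x) ∈ W := by
    refine Submodule.topologicalClosure_minimal _ (Submodule.span_le.mpr ?_) hW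
      (α.podles ▸ Submodule.mem_top)
    rintro _ ⟨y, f, rfl⟩
    change α.ρAt 0 (α.ρ y 0 * algebraMap ℂ X (f 0)) = α.ρ y 0 * algebraMap ℂ X (f 0)
    rw [map_mul, AlgHomClass.commutes, ρAt_apply, α.coassoc, add_zero]
  exact hmem

end ZNAction

section RegularRepresentation

variable {N : ℕ} [NeZero N] {H : Type*} [NormedAddCommGroup H] [InnerProductSpace ℂ H]

/-- The translation `(ξ_s)_s ↦ (ξ_{s+t})_s` of the Hilbert sum of `N` copies of `H`. -/
def lpShift (H : Type*) [NormedAddCommGroup H] [InnerProductSpace ℂ H] (t : ZMod N) :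
    lp (fun _ : ZMod N => H) 2 ≃ₗᵢ[ℂ] lp (fun _ : ZMod N => H) 2 :=
  (lpPiLpₗᵢ _ ℂ).trans
    ((LinearIsometryEquiv.piLpCongrLeft 2 ℂ H (Equiv.subRight t)).trans (lpPiLpₗᵢ _ ℂ).symm)

/-- The regular representation of `ℤ/Nℤ` with multiplicity space `H`. -/
def regularRep (N : ℕ) [NeZero N] (H : Type*) [NormedAddCommGroup H] [InnerProductSpace ℂ H]
    [CompleteSpace H] : ZNRep N (lp (fun _ : ZMod N => H) 2) where
  π t := Unitary.linearIsometryEquiv.symm (lpShift H t)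
  π_zero := by
    ext f s
    change f (s + 0) = f s
    rw [add_zero]
  π_add t t' := by
    ext f s
    change f (s + (t + t')) = f (s + t + t')
    rw [add_assoc]
  π_mem t := (Unitary.linearIsometryEquiv.symm (lpShift H t)).2

variable [CompleteSpace H]

/-- The equivariant representation `(x ξ)_s = σ(ρ_s(x)) ξ_s` induced from a faithful
representation `σ` that need not be covariant. -/
def inducedEquivRep {X : Type*} [CStarAlgebra X] (α : ZNAction N X) (σ : X →⋆ₐ[ℂ] (H →L[ℂ] H))
    (hσ : Function.Injective σ) : EquivRep α (lp (fun _ : ZMod N => H) 2) where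
  U := regularRep N H
  hom := directSumHom fun s => σ.comp (α.ρAt s)
  injective := directSumHom_injective fun x hx =>
    (map_eq_zero_iff σ hσ).mp (by
      simpa only [StarAlgHom.comp_apply, ZNAction.ρAt_apply, ZNAction.ρ_zero] using hx 0)
  covariant t x := by
    ext f s
    rw [ZNRep.star_π]
    change σ (α.ρ (α.ρ x t) s) (f s) = σ (α.ρ x (s + t)) (f (s + t + -t))
    rw [α.coassoc, add_neg_cancel_right]

end RegularRepresentation

theorem ZNAction.exists_equivRep {N : ℕ} [NeZero N] {X : Type u} [CStarAlgebra X]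
    (α : ZNAction N X) :
    ∃ (L : Type u) (_ : NormedAddCommGroup L) (_ : InnerProductSpace ℂ L) (_ : CompleteSpace L),
      Nonempty (EquivRep α L) := by
  obtain ⟨H, _, _, _, σ, hσ⟩ := exists_injective_starAlgHom X
  exact ⟨lp (fun _ : ZMod N => H) 2, inferInstance, inferInstance, inferInstance,
    ⟨inducedEquivRep α σ hσ⟩⟩

/-! ### Spans of products -/

section SpanMul

variable {A B R : Type*} [Semiring A] [Algebra ℂ A] [Star A] [Semiring B] [Algebra ℂ B] [Star B]
  [Ring R] [StarRing R] [Algebra ℂ R]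

/-- The span of the products `f x * g y`. -/
def spanMul (f : A →⋆ₐ[ℂ] R) (g : B →⋆ₐ[ℂ] R) : Submodule ℂ R :=
  Submodule.span ℂ {T | ∃ x y, T = f x * g y}

variable {f : A →⋆ₐ[ℂ] R} {g : B →⋆ₐ[ℂ] R}

theorem map_mul_map_mem_spanMul (x : A) (y : B) : f x * g y ∈ spanMul f g :=
  Submodule.subset_span ⟨x, y, rfl⟩

theorem spanMul_le {S : Submodule ℂ R} : spanMul f g ≤ S ↔ ∀ x y, f x * g y ∈ S := by
  refine Submodule.span_le.trans ⟨fun h x y => h ⟨x, y, rfl⟩, ?_⟩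
  rintro h _ ⟨x, y, rfl⟩
  exact h x y

theorem one_mem_spanMul : (1 : R) ∈ spanMul f g := by
  simpa only [map_one, mul_one] using map_mul_map_mem_spanMul (f := f) (g := g) 1 1

theorem map_mul_mem_spanMul (x : A) {s : R} (hs : s ∈ spanMul f g) : f x * s ∈ spanMul f g := by
  have h : spanMul f g ≤ (spanMul f g).comap (LinearMap.mulLeft ℂ (f x)) :=
    spanMul_le.mpr fun x' y => by
      rw [Submodule.mem_comap, LinearMap.mulLeft_apply, ← mul_assoc, ← map_mul]
      exact map_mul_map_mem_spanMul _ _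
  exact h hs

theorem mul_map_mem_spanMul (y : B) {s : R} (hs : s ∈ spanMul f g) : s * g y ∈ spanMul f g := by
  have h : spanMul f g ≤ (spanMul f g).comap (LinearMap.mulRight ℂ (g y)) :=
    spanMul_le.mpr fun x y' => by
      rw [Submodule.mem_comap, LinearMap.mulRight_apply, mul_assoc, ← map_mul]
      exact map_mul_map_mem_spanMul _ _
  exact h hs

section Adjoin

variable [StarModule ℂ R]

theorem star_mem_spanMul_of_swap {s : R} (hs : s ∈ spanMul g f) : star s ∈ spanMul f g := by
  have h : spanMul g f ≤ (spanMul f g).comap (starLinearEquiv ℂ (A := R)).toLinearMap :=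
    spanMul_le.mpr fun y x => by
      change star (g y * f x) ∈ spanMul f g
      rw [star_mul, ← map_star, ← map_star]
      exact map_mul_map_mem_spanMul _ _
  exact h hs

theorem adjoin_subset_spanMul (h : spanMul g f ≤ spanMul f g) :
    (StarAlgebra.adjoin ℂ {T | ∃ x y, T = f x * g y} : Set R) ⊆ spanMul f g := by
  intro s hs
  have hmul : spanMul f g * spanMul f g ≤ spanMul f g := by
    refine Submodule.mul_le.mpr fun s hs t ht => ?_
    have hle : spanMul f g ≤ (spanMul f g).comap (LinearMap.mulRight ℂ t) :=
      spanMul_le.mpr fun x y => ?_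
    · exact hle hs
    have hle' : spanMul f g ≤ (spanMul f g).comap (LinearMap.mulLeft ℂ (f x * g y)) :=
      spanMul_le.mpr fun x' y' => by
        rw [Submodule.mem_comap, LinearMap.mulLeft_apply, mul_assoc, ← mul_assoc (g y)]
        exact map_mul_mem_spanMul x
          (mul_map_mem_spanMul y' (h (map_mul_map_mem_spanMul y x')))
    exact hle' ht
  induction hs using StarAlgebra.adjoin_induction with
  | mem s hs => exact Submodule.subset_span hs
  | algebraMap c =>
    rw [Algebra.algebraMap_eq_smul_one]
    exact Submodule.smul_mem _ c one_mem_spanMul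
  | add s t _ _ hs ht => exact add_mem hs ht
  | mul s t _ _ hs ht => exact hmul (Submodule.mul_mem_mul hs ht)
  | star s _ hs => exact h (star_mem_spanMul_of_swap hs)

end Adjoin

end SpanMul

section Closure

variable {A B C P Q : Type*} [Ring A] [StarRing A] [Algebra ℂ A] [Ring B] [StarRing B] [Algebra ℂ B]
  [CStarAlgebra P] [CStarAlgebra Q]

theorem starAlgHom_ext_of_spanMul {f : A →⋆ₐ[ℂ] P} {g : B →⋆ₐ[ℂ] P}
    (hd : (spanMul f g).topologicalClosure = ⊤) {φ ψ : P →⋆ₐ[ℂ] Q}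
    (h : ∀ x y, φ (f x * g y) = ψ (f x * g y)) : φ = ψ := by
  have hcl : IsClosed (LinearMap.eqLocus φ.toLinearMap ψ.toLinearMap : Set P) :=
    isClosed_eq (continuous_hom φ) (continuous_hom ψ)
  have hle : (spanMul f g).topologicalClosure ≤ LinearMap.eqLocus φ.toLinearMap ψ.toLinearMap :=
    Submodule.topologicalClosure_minimal _ (spanMul_le.mpr h) hcl
  rw [hd] at hle
  exact StarAlgHom.ext fun x => hle (Submodule.mem_top (x := x))

theorem exists_starAlgHom_of_graph {𝒢 : StarSubalgebra ℂ (P × Q)}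
    (hcl : IsClosed (𝒢 : Set (P × Q))) (hd : Dense (Prod.fst '' (𝒢 : Set (P × Q))))
    (h0 : ∀ z ∈ 𝒢, z.1 = 0 → z.2 = 0) : ∃ Φ : P →⋆ₐ[ℂ] Q, ∀ z ∈ 𝒢, Φ z.1 = z.2 := by
  let p : 𝒢 →⋆ₐ[ℂ] P := (StarAlgHom.fst ℂ P Q).comp 𝒢.subtype
  have hp : Function.Injective p := (injective_iff_map_eq_zero p).mpr fun z hz =>
    Subtype.ext (Prod.ext hz (h0 z.1 z.2 hz))
  have hrange : IsClosed (Set.range p) :=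
    (NonUnitalStarAlgHom.isometry p hp).isClosedEmbedding.isClosed_range
  have hsurj : Function.Surjective p := by
    refine Set.range_eq_univ.mp (hrange.closure_eq.symm.trans (hd.mono ?_).closure_eq)
    rintro _ ⟨z, hz, rfl⟩
    exact ⟨⟨z, hz⟩, rfl⟩
  let e := StarAlgEquiv.ofBijective p ⟨hp, hsurj⟩
  refine ⟨((StarAlgHom.snd ℂ P Q).comp 𝒢.subtype).comp e.symm.toStarAlgHom, fun z hz => ?_⟩
  have hw : e.symm z.1 = ⟨z, hz⟩ := e.symm_apply_eq.mpr rfl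
  change (e.symm z.1).1.2 = z.2
  rw [hw]

theorem exists_starAlgHom_map_mul {f : A →⋆ₐ[ℂ] P} {g : B →⋆ₐ[ℂ] P} {f' : A →⋆ₐ[ℂ] Q}
    {g' : B →⋆ₐ[ℂ] Q} (hd : (spanMul f g).topologicalClosure = ⊤)
    (hcomm : spanMul (g.prod g') (f.prod f') ≤ spanMul (f.prod f') (g.prod g'))
    (h0 : ∀ z ∈ (spanMul (f.prod f') (g.prod g')).topologicalClosure, z.1 = 0 → z.2 = 0) :
    ∃ Φ : P →⋆ₐ[ℂ] Q, ∀ x y, Φ (f x * g y) = f' x * g' y := by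
  set 𝒮 := StarAlgebra.adjoin ℂ {T | ∃ x y, T = f.prod f' x * g.prod g' y}
  have hmem (x y) : f.prod f' x * g.prod g' y ∈ 𝒮.topologicalClosure :=
    𝒮.le_topologicalClosure (StarAlgebra.subset_adjoin ℂ _ ⟨x, y, rfl⟩)
  have hspan : spanMul f g ≤ (𝒮.topologicalClosure.toSubalgebra.toSubmodule).map
      (LinearMap.fst ℂ P Q) := spanMul_le.mpr fun x y => ⟨_, hmem x y, rfl⟩
  have hdense : Dense (Prod.fst '' (𝒮.topologicalClosure : Set (P × Q))) :=
    (Submodule.dense_iff_topologicalClosure_eq_top.mpr hd).mono hspan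
  obtain ⟨Φ, hΦ⟩ := exists_starAlgHom_of_graph 𝒮.isClosed_topologicalClosure hdense
    fun z hz => h0 z (closure_mono (adjoin_subset_spanMul hcomm) hz)
  exact ⟨Φ, fun x y => hΦ _ (hmem x y)⟩

theorem mul_map_mem_of_dense_adjoin [CStarAlgebra C] {S : Submodule ℂ P}
    (hS : IsClosed (S : Set P)) {b : C →⋆ₐ[ℂ] P} {G : Set C}
    (hG : Dense (Algebra.adjoin ℂ G : Set C)) (h : ∀ c ∈ G, ∀ s ∈ S, s * b c ∈ S) (c : C) :
    ∀ s ∈ S, s * b c ∈ S := by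
  intro s hs
  have hadjoin : ∀ c ∈ Algebra.adjoin ℂ G, ∀ s ∈ S, s * b c ∈ S := by
    intro c hc
    induction hc using Algebra.adjoin_induction with
    | mem c hc => exact h c hc
    | algebraMap r =>
      intro s hs
      rw [AlgHomClass.commutes, ← Algebra.commutes, ← Algebra.smul_def]
      exact S.smul_mem r hs
    | add c d _ _ hc hd =>
      intro s hs
      rw [map_add, mul_add]
      exact add_mem (hc s hs) (hd s hs)
    | mul c d _ _ hc hd =>
      intro s hs
      rw [map_mul, ← mul_assoc]
      exact hd _ (hc s hs)
  have hcl : IsClosed {c | s * b c ∈ S} := hS.preimage (continuous_const.mul (continuous_hom b))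
  exact closure_minimal (fun c hc => hadjoin c hc s hs) hcl (hG c)

theorem spanMul_le_topologicalClosure_spanMul [CStarAlgebra C] {Δ : A →⋆ₐ[ℂ] P} {a : B →⋆ₐ[ℂ] P}
    {b : C →⋆ₐ[ℂ] P} {G : Set C} (hG : Dense (Algebra.adjoin ℂ G : Set C))
    (hb : ∀ g ∈ G, b g ∈ spanMul Δ a) (hab : ∀ g ∈ G, ∀ y, ∃ y', a y * b g = b g * a y') :
    spanMul b a ≤ (spanMul Δ a).topologicalClosure := by
  set S := (spanMul Δ a).topologicalClosure
  have hS : IsClosed (S : Set P) := Submodule.isClosed_topologicalClosure _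
  have hmul_a {s : P} (hs : s ∈ S) (y : B) : s * a y ∈ S :=
    map_mem_closure (f := (· * a y)) (continuous_mul_const _) hs fun _ => mul_map_mem_spanMul y
  have hmul_b : ∀ g ∈ G, ∀ s ∈ S, s * b g ∈ S := by
    intro g hg s hs
    have hle : spanMul Δ a ≤ (spanMul Δ a).comap (LinearMap.mulRight ℂ (b g)) :=
      spanMul_le.mpr fun x y => by
        obtain ⟨y', hy'⟩ := hab g hg y
        rw [Submodule.mem_comap, LinearMap.mulRight_apply, mul_assoc, hy', ← mul_assoc]
        exact mul_map_mem_spanMul y' (map_mul_mem_spanMul x (hb g hg))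
    exact map_mem_closure (f := (· * b g)) (continuous_mul_const _) hs hle
  have hone : (1 : P) ∈ S := Submodule.le_topologicalClosure _ one_mem_spanMul
  refine spanMul_le.mpr fun c y => hmul_a ?_ y
  simpa only [one_mul] using
    mul_map_mem_of_dense_adjoin hS hG hmul_b c 1 hone

end Closure

/-! ### Homogeneous elements -/

namespace ZNAction

variable {N : ℕ} [NeZero N] {ω : ℂ} {X Y : Type*} [CStarAlgebra X] [CStarAlgebra Y]
  {α : ZNAction N X} {β : ZNAction N Y}

/-- The elements of degree `m`, those with `ρ_t(x) = ω ^ (t m) x` for all `t`. -/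
def IsHomogeneous (α : ZNAction N X) (ω : ℂ) (m : ZMod N) (x : X) : Prop :=
  ∀ t, α.ρ x t = chi ω (t * m) • x

theorem IsHomogeneous.map {m : ZMod N} {x : X} (hx : α.IsHomogeneous ω m x) {φ : X →⋆ₐ[ℂ] Y}
    (hφ : IsEquivariant α β φ) : β.IsHomogeneous ω m (φ x) := fun t => by
  rw [hφ, hx, map_smul]

theorem IsHomogeneous.star (hω : IsPrimitiveRoot ω N) {m : ZMod N} {x : X}
    (hx : α.IsHomogeneous ω m x) : α.IsHomogeneous ω (-m) (star x) := fun t => by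
  rw [map_star, Pi.star_apply, hx, star_smul, star_chi hω, mul_neg]

theorem IsHomogeneous.mul (hω : IsPrimitiveRoot ω N) {m n : ZMod N} {x y : X}
    (hx : α.IsHomogeneous ω m x) (hy : α.IsHomogeneous ω n y) :
    α.IsHomogeneous ω (m + n) (x * y) := fun t => by
  rw [map_mul, Pi.mul_apply, hx, hy, smul_mul_smul_comm, ← chi_add hω, mul_add]

theorem IsHomogeneous.sum {ι : Type*} {s : Finset ι} {m : ZMod N} {x : ι → X}
    (hx : ∀ k ∈ s, α.IsHomogeneous ω m (x k)) : α.IsHomogeneous ω m (∑ k ∈ s, x k) := fun t => by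
  rw [map_sum, Finset.sum_apply, Finset.smul_sum]
  exact Finset.sum_congr rfl fun k hk => hx k hk t

/-- The component of degree `m` of an element, its Fourier coefficient at `m`. -/
def component (α : ZNAction N X) (ω : ℂ) (m : ZMod N) (x : X) : X :=
  (N : ℂ)⁻¹ • ∑ t : ZMod N, chi ω (-(t * m)) • α.ρ x t

theorem isHomogeneous_component (hω : IsPrimitiveRoot ω N) (m : ZMod N) (x : X) :
    α.IsHomogeneous ω m (α.component ω m x) := fun t => by
  rw [component, map_smul, Pi.smul_apply, map_sum, Finset.sum_apply, smul_comm (chi ω (t * m))]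
  refine congrArg (fun z : X => (N : ℂ)⁻¹ • z) ?_
  rw [Finset.smul_sum]
  refine Fintype.sum_equiv (Equiv.addLeft t) _ _ fun s => ?_
  rw [map_smul, Pi.smul_apply, α.coassoc, Equiv.coe_addLeft, smul_smul, ← chi_add hω]
  congr 2
  ring

theorem sum_component (hω : IsPrimitiveRoot ω N) (x : X) : ∑ m, α.component ω m x = x := by
  have hchi : ∀ t : ZMod N, ∑ m : ZMod N, chi ω (-(t * m)) = if t = 0 then (N : ℂ) else 0 := by
    intro t
    simpa only [mul_neg, mul_comm, neg_eq_zero] using sum_chi hω (-t)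
  simp only [component, ← Finset.smul_sum]
  rw [Finset.sum_comm]
  simp [← Finset.sum_smul, hchi, smul_smul, NeZero.ne N]

theorem map_component {φ : X →⋆ₐ[ℂ] Y} (hφ : IsEquivariant α β φ) (m : ZMod N) (x : X) :
    φ (α.component ω m x) = β.component ω m (φ x) := by
  simp only [component, map_smul, map_sum, hφ x _]

theorem starAlgHom_ext_of_isHomogeneous (hω : IsPrimitiveRoot ω N) {Q : Type*} [Semiring Q]
    [Algebra ℂ Q] [Star Q] {φ ψ : X →⋆ₐ[ℂ] Q}
    (h : ∀ m x, α.IsHomogeneous ω m x → φ x = ψ x) : φ = ψ := by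
  ext x
  rw [← α.sum_component hω x, map_sum, map_sum]
  exact Finset.sum_congr rfl fun m _ => h m _ (isHomogeneous_component hω m x)

theorem spanMul_le_spanMul_swap (hω : IsPrimitiveRoot ω N) {B R : Type*} [Semiring B] [Algebra ℂ B]
    [Star B] [Ring R] [StarRing R] [Algebra ℂ R] {a : X →⋆ₐ[ℂ] R} {b : B →⋆ₐ[ℂ] R}
    (h : ∀ m x, α.IsHomogeneous ω m x → ∀ y, ∃ y', b y * a x = a x * b y') :
    spanMul b a ≤ spanMul a b := by
  refine spanMul_le.mpr fun y x => ?_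
  rw [← α.sum_component hω x, map_sum, Finset.mul_sum]
  refine Submodule.sum_mem _ fun m _ => ?_
  obtain ⟨y', hy'⟩ := h m _ (isHomogeneous_component hω m x) y
  rw [hy']
  exact map_mul_map_mem_spanMul _ y'

end ZNAction

namespace ZNRep

variable {N : ℕ} [NeZero N] {ω : ℂ} {L K : Type*} [NormedAddCommGroup L] [InnerProductSpace ℂ L]
  [CompleteSpace L] [NormedAddCommGroup K] [InnerProductSpace ℂ K] [CompleteSpace K]

/-- The action on the bounded operators by conjugation with the representation. -/
def opAction (U : ZNRep N L) : ZNAction N (L →L[ℂ] L) :=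
  ZNAction.ofFamily U.conj
    (fun x => by rw [conj_apply, U.π_zero, star_one, one_mul, mul_one])
    (fun s t x => by simp only [conj_apply, U.π_add, star_mul, mul_assoc])

theorem leg₁Hom_equivariant (U : ZNRep N L) (V : ZNRep N K) :
    ZNAction.IsEquivariant U.opAction (U.tensor V).opAction (leg₁Hom L K) :=
  fun x t => conj_leg₁ U V t x

theorem leg₂Hom_equivariant (hω : IsPrimitiveRoot ω N) (U : ZNRep N L) (V : ZNRep N K) :
    ZNAction.IsEquivariant V.opAction (U.tensor V).opAction (leg₂Hom hω U V) :=
  fun y t => conj_leg₂ hω U V t y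

end ZNRep

theorem EquivRep.hom_equivariant {N : ℕ} [NeZero N] {X : Type*} [CStarAlgebra X]
    {α : ZNAction N X} {L : Type*} [NormedAddCommGroup L] [InnerProductSpace ℂ L] [CompleteSpace L]
    (θ : EquivRep α L) : ZNAction.IsEquivariant α θ.U.opAction θ.hom :=
  fun x t => (θ.covariant t x).symm

/-! ### Commutation relations of the legs -/

namespace ZNRep

variable {N : ℕ} [NeZero N] {ω : ℂ} {L K : Type*} [NormedAddCommGroup L] [InnerProductSpace ℂ L]
  [CompleteSpace L] [NormedAddCommGroup K] [InnerProductSpace ℂ K] [CompleteSpace K]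

/-- The braiding `L ⊗ K → K ⊗ L` as an isomorphism of Hilbert spaces. -/
def braidEquiv (hω : IsPrimitiveRoot ω N) (U : ZNRep N L) (V : ZNRep N K) :
    HilbertTensor L K ≃ₗᵢ[ℂ] HilbertTensor K L where
  toLinearEquiv := LinearEquiv.ofLinearMap (braid ω U V).toLinearMap (dualBraid ω U V).toLinearMap
    (congrArg ContinuousLinearMap.toLinearMap (braid_comp_dualBraid hω U V))
    (congrArg ContinuousLinearMap.toLinearMap (dualBraid_comp_braid hω U V))
  norm_map' := (ContinuousLinearMap.norm_map_iff_adjoint_comp_self _).mpr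
    ((congrArg (· ∘L braid ω U V) (adjoint_braid hω U V)).trans (dualBraid_comp_braid hω U V))

theorem conj_braidEquiv_leg₂ (hω : IsPrimitiveRoot ω N) (U : ZNRep N L) (V : ZNRep N K)
    (y : K →L[ℂ] K) :
    (braidEquiv hω U V).conjStarAlgEquiv (leg₂ ω U V y) = HilbertTensor.map y 1 :=
  (braidEquiv hω U V).conjStarAlgEquiv.apply_symm_apply _

theorem π_apply_of_degree (hω : IsPrimitiveRoot ω N) (U : ZNRep N L) {x : L →L[ℂ] L} {m : ZMod N}
    (hx : U.opAction.IsHomogeneous ω m x) {ξ : L} {a : ZMod N}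
    (hξ : ∀ t, U.π t ξ = chi ω (t * a) • ξ) (t : ZMod N) :
    U.π t (x ξ) = chi ω (t * (m + a)) • x ξ := by
  have hconj : U.conj t x (U.π t ξ) = U.π t (x ξ) := by
    rw [conj_apply, star_π, mul_apply_eq_comp, mul_apply_eq_comp, ← mul_apply_eq_comp (U.π (-t)),
      ← U.π_add, neg_add_cancel, U.π_zero, one_apply_eq_self]
  have hdeg : U.conj t x = chi ω (t * m) • x := hx t
  rw [← hconj, hdeg, hξ, map_smul, smul_apply, smul_smul, ← chi_add hω, mul_add, add_comm]

theorem conj_braidEquiv_leg₁ (hω : IsPrimitiveRoot ω N) (U : ZNRep N L) (V : ZNRep N K)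
    {x : L →L[ℂ] L} {m : ZMod N} (hx : U.opAction.IsHomogeneous ω m x) :
    (braidEquiv hω U V).conjStarAlgEquiv (leg₁ K x) = HilbertTensor.map (V.π m) x := by
  have h : braid ω U V ∘L leg₁ K x = HilbertTensor.map (V.π m) x ∘L braid ω U V := by
    refine ext_degree hω U V fun ξ η a b hξ hη => ?_
    rw [ContinuousLinearMap.comp_apply, ContinuousLinearMap.comp_apply, leg₁,
      HilbertTensor.map_tmul, one_apply_eq_self,
      braid_tmul hω U V (π_apply_of_degree hω U hx hξ) hη, braid_tmul hω U V hξ hη, map_smul,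
      HilbertTensor.map_tmul, hη, HilbertTensor.smul_tmul, smul_smul, ← chi_add hω]
    congr 2
    ring
  refine ContinuousLinearMap.ext fun z => ?_
  exact (DFunLike.congr_fun h ((braidEquiv hω U V).symm z)).trans
    (congrArg (HilbertTensor.map (V.π m) x) ((braidEquiv hω U V).apply_symm_apply z))

theorem leg₂_of_degree (hω : IsPrimitiveRoot ω N) (U : ZNRep N L) (V : ZNRep N K) {y : K →L[ℂ] K}
    {n : ZMod N} (hy : V.opAction.IsHomogeneous ω n y) :
    leg₂ ω U V y = HilbertTensor.map (U.π (-n)) y := by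
  refine ext_degree hω U V fun ξ η a b hξ hη => ?_
  rw [leg₂, ContinuousLinearMap.comp_apply, ContinuousLinearMap.comp_apply,
    braid_tmul hω U V hξ hη, map_smul, map_smul, HilbertTensor.map_tmul, one_apply_eq_self,
    dualBraid_tmul hω U V hξ (π_apply_of_degree hω V hy hη), HilbertTensor.map_tmul, hξ,
    HilbertTensor.smul_tmul, smul_smul, ← chi_add hω]
  congr 2
  ring

theorem leg₂_mul_leg₁ (hω : IsPrimitiveRoot ω N) (U : ZNRep N L) (V : ZNRep N K)
    {x : L →L[ℂ] L} {m : ZMod N} (hx : U.opAction.IsHomogeneous ω m x) (y : K →L[ℂ] K) :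
    leg₂ ω U V y * leg₁ K x = leg₁ K x * leg₂ ω U V (V.conj (-m) y) := by
  have hcomm : y * V.π m = V.π m * V.conj (-m) y := by
    rw [conj_apply, star_π, neg_neg, ← mul_assoc, ← mul_assoc, ← V.π_add, add_neg_cancel, V.π_zero,
      one_mul]
  refine EquivLike.injective (braidEquiv hω U V).conjStarAlgEquiv ?_
  rw [map_mul, map_mul, conj_braidEquiv_leg₁ hω U V hx, conj_braidEquiv_leg₂, conj_braidEquiv_leg₂,
    HilbertTensor.map_mul_map, HilbertTensor.map_mul_map, hcomm, one_mul, mul_one]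

theorem leg₁_mul_leg₂ (hω : IsPrimitiveRoot ω N) (U : ZNRep N L) (V : ZNRep N K)
    (x : L →L[ℂ] L) {y : K →L[ℂ] K} {n : ZMod N} (hy : V.opAction.IsHomogeneous ω n y) :
    leg₁ K x * leg₂ ω U V y = leg₂ ω U V y * leg₁ K (U.conj n x) := by
  have hcomm : x * U.π (-n) = U.π (-n) * U.conj n x := by
    rw [conj_apply, star_π, ← mul_assoc, ← mul_assoc, ← U.π_add, neg_add_cancel, U.π_zero, one_mul]
  rw [leg₂_of_degree hω U V hy, leg₁, leg₁, HilbertTensor.map_mul_map, HilbertTensor.map_mul_map,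
    hcomm, one_mul, mul_one]

end ZNRep

/-! ### The two factors of the braided tensor product -/

namespace Braided

variable {N : ℕ} [NeZero N] {ω : ℂ} {X Y : Type*} [CStarAlgebra X] [CStarAlgebra Y]
  {α : ZNAction N X} {β : ZNAction N Y}
  {L K : Type*} [NormedAddCommGroup L] [InnerProductSpace ℂ L] [CompleteSpace L]
  [NormedAddCommGroup K] [InnerProductSpace ℂ K] [CompleteSpace K]
  (hω : IsPrimitiveRoot ω N) (θ : EquivRep α L) (κ : EquivRep β K)

theorem j₂_mul_j₁ {m : ZMod N} {x : X} (hx : α.IsHomogeneous ω m x) (y : Y) :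
    j₂ hω θ κ y * j₁ hω θ κ x = j₁ hω θ κ x * j₂ hω θ κ (β.ρ y (-m)) := by
  have h := ZNRep.leg₂_mul_leg₁ hω θ.U κ.U (hx.map θ.hom_equivariant) (κ.hom y)
  exact Subtype.ext (h.trans (congrArg (fun T => ZNRep.leg₁ K (θ.hom x) * ZNRep.leg₂ ω θ.U κ.U T)
    (κ.hom_equivariant y (-m))))

theorem j₁_mul_j₂ (x : X) {n : ZMod N} {y : Y} (hy : β.IsHomogeneous ω n y) :
    j₁ hω θ κ x * j₂ hω θ κ y = j₂ hω θ κ y * j₁ hω θ κ (α.ρ x n) := by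
  have h := ZNRep.leg₁_mul_leg₂ hω θ.U κ.U (θ.hom x) (hy.map κ.hom_equivariant)
  exact Subtype.ext (h.trans (congrArg (fun T => ZNRep.leg₂ ω θ.U κ.U (κ.hom y) * ZNRep.leg₁ K T)
    (θ.hom_equivariant x n)))

theorem spanMul_j₂_j₁ : spanMul (j₂ hω θ κ) (j₁ hω θ κ) = spanMul (j₁ hω θ κ) (j₂ hω θ κ) :=
  le_antisymm
    (α.spanMul_le_spanMul_swap hω fun _ _ hx y => ⟨_, j₂_mul_j₁ hω θ κ hx y⟩)
    (β.spanMul_le_spanMul_swap hω fun _ _ hy x => ⟨_, j₁_mul_j₂ hω θ κ x hy⟩)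

theorem topologicalClosure_spanMul :
    (spanMul (j₁ hω θ κ) (j₂ hω θ κ)).topologicalClosure = ⊤ := by
  set 𝒮 := StarAlgebra.adjoin ℂ {T | ∃ x y, T = j₁ hω θ κ x * j₂ hω θ κ y}
  have hgen : StarAlgebra.adjoin ℂ {T | ∃ x y,
      T = ZNRep.leg₁ K (θ.hom x) * ZNRep.leg₂ ω θ.U κ.U (κ.hom y)} ≤
      𝒮.map (Braided ω θ κ).subtype := by
    refine StarAlgebra.adjoin_le ?_
    rintro _ ⟨x, y, rfl⟩
    exact ⟨j₁ hω θ κ x * j₂ hω θ κ y, StarAlgebra.subset_adjoin ℂ _ ⟨x, y, rfl⟩, rfl⟩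
  refine eq_top_iff.mpr fun T _ => ?_
  have hT : T ∈ closure (𝒮 : Set (Braided ω θ κ)) := closure_subtype.mpr (closure_mono hgen T.2)
  exact closure_mono (adjoin_subset_spanMul (spanMul_j₂_j₁ hω θ κ).le) hT

variable {hω θ κ} in
theorem hom_ext {B : Type*} [CStarAlgebra B] {f g : Braided ω θ κ →⋆ₐ[ℂ] B}
    (h : ∀ x y, f (j₁ hω θ κ x * j₂ hω θ κ y) = g (j₁ hω θ κ x * j₂ hω θ κ y)) : f = g :=
  starAlgHom_ext_of_spanMul (topologicalClosure_spanMul hω θ κ) h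

end Braided

/-! ### Functoriality of the braided tensor product -/

namespace HilbertTensor

variable {E F F' : Type*} [NormedAddCommGroup E] [InnerProductSpace ℂ E]
  [NormedAddCommGroup F] [InnerProductSpace ℂ F] [CompleteSpace F]
  [NormedAddCommGroup F'] [InnerProductSpace ℂ F'] [CompleteSpace F']

/-- The operator `y ↦ x ⊗ y`. -/
def tmulCLM (x : E) : F →L[ℂ] HilbertTensor E F := coeL E F ∘L TensorProduct.mkL ℂ E F x

/-- The slice of an operator by the functional `⟪e, · f⟫` on the first tensor factor. -/
def slice (e f : E) :
    (HilbertTensor E F →L[ℂ] HilbertTensor E F) →L[ℂ] (F →L[ℂ] F) :=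
  (ContinuousLinearMap.compL ℂ F (HilbertTensor E F) F (ContinuousLinearMap.adjoint (tmulCLM e))) ∘L
    (ContinuousLinearMap.compL ℂ F (HilbertTensor E F) (HilbertTensor E F)).flip (tmulCLM f)

theorem inner_slice (e f : E) (T : HilbertTensor E F →L[ℂ] HilbertTensor E F) (x y : F) :
    inner ℂ x (slice e f T y) = inner ℂ (tmul e x) (T (tmul f y)) :=
  ContinuousLinearMap.adjoint_inner_right (tmulCLM e) x (T (tmul f y))

theorem slice_map (e f : E) (S : E →L[ℂ] E) (T : F →L[ℂ] F) :
    slice e f (map S T) = inner ℂ e (S f) • T := by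
  ext y
  refine ext_inner_left ℂ fun x => ?_
  rw [inner_slice, map_tmul, inner_tmul, smul_apply, inner_smul_right]

theorem eq_zero_of_slice {T : HilbertTensor E F →L[ℂ] HilbertTensor E F}
    (h : ∀ e f, slice e f T = 0) : T = 0 := by
  have hadj : ContinuousLinearMap.adjoint T = 0 := by
    refine adjoint_eq_of_tmul fun x y x' y' => ?_
    rw [zero_apply, inner_zero_right, ← inner_conj_symm, ← inner_slice, h, zero_apply,
      inner_zero_right, _root_.map_zero]
  exact (map_eq_zero_iff _ ContinuousLinearMap.adjoint.injective).mp hadj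

-- The graph of the map sought is closed, and each pair of slices of one of its points comes from an
-- element of `X`. If the first coordinate vanishes, so does that element, as `θ` is faithful.
theorem exists_starAlgHom_of_slice {A B P Q X : Type*} [Ring A] [StarRing A] [Algebra ℂ A]
    [Ring B] [StarRing B] [Algebra ℂ B] [CStarAlgebra P] [CStarAlgebra Q] [CStarAlgebra X]
    {a : A →⋆ₐ[ℂ] P} {b : B →⋆ₐ[ℂ] P} {a' : A →⋆ₐ[ℂ] Q} {b' : B →⋆ₐ[ℂ] Q}
    (hd : (spanMul a b).topologicalClosure = ⊤)
    (hcomm : spanMul (b.prod b') (a.prod a') ≤ spanMul (a.prod a') (b.prod b'))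
    (π : P →⋆ₐ[ℂ] (HilbertTensor E F →L[ℂ] HilbertTensor E F))
    {π' : Q →⋆ₐ[ℂ] (HilbertTensor E F' →L[ℂ] HilbertTensor E F')}
    (hπ' : Function.Injective π') {θ : X →⋆ₐ[ℂ] (F →L[ℂ] F)} (hθ : Function.Injective θ)
    (θ' : X →⋆ₐ[ℂ] (F' →L[ℂ] F'))
    (hsl : ∀ x y e f, ∃ z, θ z = slice e f (π (a x * b y)) ∧
      θ' z = slice e f (π' (a' x * b' y))) :
    ∃ Φ : P →⋆ₐ[ℂ] Q, ∀ x y, Φ (a x * b y) = a' x * b' y := by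
  refine exists_starAlgHom_map_mul hd hcomm fun z hz hz0 => ?_
  have hrange : IsClosed (Set.range (θ.prod θ')) :=
    (NonUnitalStarAlgHom.isometry (θ.prod θ')
      fun _ _ h => hθ (congrArg Prod.fst h)).isClosedEmbedding.isClosed_range
  have hslices : ∀ e f, ∃ x, θ x = slice e f (π z.1) ∧ θ' x = slice e f (π' z.2) := by
    intro e f
    let D : P × Q →ₗ[ℂ] (F →L[ℂ] F) × (F' →L[ℂ] F') := LinearMap.prodMap
      ((slice e f).toLinearMap ∘ₗ π.toLinearMap) ((slice e f).toLinearMap ∘ₗ π'.toLinearMap)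
    have hD : Continuous D :=
      ((slice e f).continuous.comp (continuous_hom π)).prodMap
        ((slice e f).continuous.comp (continuous_hom π'))
    have hle : spanMul (a.prod a') (b.prod b') ≤
        (LinearMap.range (θ.prod θ').toLinearMap).comap D := spanMul_le.mpr fun x y => by
      obtain ⟨w, hw, hw'⟩ := hsl x y e f
      exact ⟨w, Prod.ext hw hw'⟩
    obtain ⟨x, hx⟩ := closure_minimal hle (hrange.preimage hD) hz
    exact ⟨x, congrArg Prod.fst hx, congrArg Prod.snd hx⟩
  refine (map_eq_zero_iff π' hπ').mp (eq_zero_of_slice fun e f => ?_)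
  obtain ⟨x, hx, hx'⟩ := hslices e f
  rw [hz0, _root_.map_zero, _root_.map_zero, map_eq_zero_iff θ hθ] at hx
  rw [← hx', hx, _root_.map_zero]

end HilbertTensor

namespace Braided

variable {N : ℕ} [NeZero N] {ω : ℂ} {X Y X' Y' : Type*} [CStarAlgebra X] [CStarAlgebra Y]
  [CStarAlgebra X'] [CStarAlgebra Y'] {α : ZNAction N X} {β : ZNAction N Y}
  {α' : ZNAction N X'} {β' : ZNAction N Y'}
  {L K L' K' : Type*} [NormedAddCommGroup L] [InnerProductSpace ℂ L] [CompleteSpace L]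
  [NormedAddCommGroup K] [InnerProductSpace ℂ K] [CompleteSpace K]
  [NormedAddCommGroup L'] [InnerProductSpace ℂ L'] [CompleteSpace L']
  [NormedAddCommGroup K'] [InnerProductSpace ℂ K'] [CompleteSpace K']
  (hω : IsPrimitiveRoot ω N) (θ : EquivRep α L) (κ : EquivRep β K)

theorem isTensorMap_of_apply_mul {hω : IsPrimitiveRoot ω N} {θ : EquivRep α L} {κ : EquivRep β K}
    {θ' : EquivRep α' L'} {κ' : EquivRep β' K'} {φ : X →⋆ₐ[ℂ] X'} {ψ : Y →⋆ₐ[ℂ] Y'}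
    (hφ : ZNAction.IsEquivariant α α' φ) (hψ : ZNAction.IsEquivariant β β' ψ)
    {Φ : Braided ω θ κ →⋆ₐ[ℂ] Braided ω θ' κ'}
    (hΦ : ∀ x y, Φ (j₁ hω θ κ x * j₂ hω θ κ y) = j₁ hω θ' κ' (φ x) * j₂ hω θ' κ' (ψ y)) :
    IsTensorMap hω θ κ θ' κ' φ ψ Φ := by
  refine ⟨fun T t => ?_, hΦ⟩
  have h : ((action hω θ' κ').ρAt t).comp Φ = Φ.comp ((action hω θ κ).ρAt t) :=
    hom_ext fun x y => by
      have hmul : (action hω θ κ).ρAt t (j₁ hω θ κ x * j₂ hω θ κ y) =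
          j₁ hω θ κ (α.ρ x t) * j₂ hω θ κ (β.ρ y t) :=
        (map_mul _ _ _).trans (congrArg₂ _ (j₁_equivariant hω θ κ x t) (j₂_equivariant hω θ κ y t))
      have hmul' : (action hω θ' κ').ρAt t (j₁ hω θ' κ' (φ x) * j₂ hω θ' κ' (ψ y)) =
          j₁ hω θ' κ' (α'.ρ (φ x) t) * j₂ hω θ' κ' (β'.ρ (ψ y) t) :=
        (map_mul _ _ _).trans
          (congrArg₂ _ (j₁_equivariant hω θ' κ' _ t) (j₂_equivariant hω θ' κ' _ t))
      rw [StarAlgHom.comp_apply, StarAlgHom.comp_apply, hΦ, hmul, hmul', hΦ, hφ, hψ]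
  exact DFunLike.congr_fun h T

/-- The representation of `X ⊠ Y` on `K ⊗ L` obtained by conjugation with the braiding. -/
def braidRep : Braided ω θ κ →⋆ₐ[ℂ] (HilbertTensor K L →L[ℂ] HilbertTensor K L) :=
  (ZNRep.braidEquiv hω θ.U κ.U).conjStarAlgEquiv.toStarAlgHom.comp (Braided ω θ κ).subtype

theorem braidRep_injective : Function.Injective (braidRep hω θ κ) :=
  (EquivLike.injective (ZNRep.braidEquiv hω θ.U κ.U).conjStarAlgEquiv).comp Subtype.val_injective

theorem slice_braidRep (x : X) (y : Y) (e f : K) :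
    HilbertTensor.slice e f (braidRep hω θ κ (j₁ hω θ κ x * j₂ hω θ κ y)) =
      θ.hom (∑ m, inner ℂ e ((κ.U.π m * κ.hom y) f) • α.component ω m x) := by
  have hj₁ : ∀ m, braidRep hω θ κ (j₁ hω θ κ (α.component ω m x)) =
      HilbertTensor.map (κ.U.π m) (θ.hom (α.component ω m x)) := fun m =>
    ZNRep.conj_braidEquiv_leg₁ hω θ.U κ.U
      ((ZNAction.isHomogeneous_component hω m x).map θ.hom_equivariant)
  have hj₂ : braidRep hω θ κ (j₂ hω θ κ y) = HilbertTensor.map (κ.hom y) 1 :=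
    ZNRep.conj_braidEquiv_leg₂ hω θ.U κ.U (κ.hom y)
  conv_lhs => rw [← α.sum_component hω x]
  simp only [map_sum, map_mul, Finset.sum_mul, hj₁, hj₂, map_smul, HilbertTensor.map_mul_map,
    HilbertTensor.slice_map, mul_one]

theorem slice_subtype (x : X) (y : Y) (e f : L) :
    HilbertTensor.slice e f ((Braided ω θ κ).subtype (j₁ hω θ κ x * j₂ hω θ κ y)) =
      κ.hom (∑ n, inner ℂ e ((θ.hom x * θ.U.π (-n)) f) • β.component ω n y) := by
  have hj₁ : (Braided ω θ κ).subtype (j₁ hω θ κ x) = HilbertTensor.map (θ.hom x) 1 := rfl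
  have hj₂ : ∀ n, (Braided ω θ κ).subtype (j₂ hω θ κ (β.component ω n y)) =
      HilbertTensor.map (θ.U.π (-n)) (κ.hom (β.component ω n y)) := fun n =>
    ZNRep.leg₂_of_degree hω θ.U κ.U
      ((ZNAction.isHomogeneous_component hω n y).map κ.hom_equivariant)
  conv_lhs => rw [← β.sum_component hω y]
  simp only [map_sum, map_mul, Finset.mul_sum, hj₁, hj₂, map_smul, HilbertTensor.map_mul_map,
    HilbertTensor.slice_map, one_mul]

variable {hω θ κ} in
theorem spanMul_prod_swap {θ' : EquivRep α' L'} {κ' : EquivRep β' K'} {φ : X →⋆ₐ[ℂ] X'}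
    {ψ : Y →⋆ₐ[ℂ] Y'} (hφ : ZNAction.IsEquivariant α α' φ)
    (hψ : ZNAction.IsEquivariant β β' ψ) :
    spanMul ((j₂ hω θ κ).prod ((j₂ hω θ' κ').comp ψ)) ((j₁ hω θ κ).prod ((j₁ hω θ' κ').comp φ)) ≤
      spanMul ((j₁ hω θ κ).prod ((j₁ hω θ' κ').comp φ))
        ((j₂ hω θ κ).prod ((j₂ hω θ' κ').comp ψ)) := by
  refine α.spanMul_le_spanMul_swap hω fun m x hx y =>
    ⟨β.ρ y (-m), Prod.ext (j₂_mul_j₁ hω θ κ hx y) ?_⟩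
  have h := j₂_mul_j₁ hω θ' κ' (hx.map hφ) (ψ y)
  rw [hψ] at h
  exact h

theorem exists_isTensorMap_left (θ' : EquivRep α' L') {φ : X →⋆ₐ[ℂ] X'}
    (hφ : ZNAction.IsEquivariant α α' φ) :
    ∃ Φ, IsTensorMap hω θ κ θ' κ φ (StarAlgHom.id ℂ Y) Φ := by
  have hid : ZNAction.IsEquivariant β β (StarAlgHom.id ℂ Y) := fun _ _ => rfl
  have hslice : ∀ x y e f, ∃ z,
      θ.hom z = HilbertTensor.slice e f (braidRep hω θ κ (j₁ hω θ κ x * j₂ hω θ κ y)) ∧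
      (θ'.hom.comp φ) z =
        HilbertTensor.slice e f (braidRep hω θ' κ (j₁ hω θ' κ (φ x) * j₂ hω θ' κ y)) :=
    fun x y e f => ⟨_, (slice_braidRep hω θ κ x y e f).symm, by
      simp only [slice_braidRep, StarAlgHom.comp_apply, map_sum, map_smul,
        ZNAction.map_component hφ]⟩
  obtain ⟨Φ, hΦ⟩ := HilbertTensor.exists_starAlgHom_of_slice
    (a' := (j₁ hω θ' κ).comp φ) (b' := (j₂ hω θ' κ).comp (StarAlgHom.id ℂ Y))
    (topologicalClosure_spanMul hω θ κ) (spanMul_prod_swap hφ hid) (braidRep hω θ κ)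
    (braidRep_injective hω θ' κ) θ.injective (θ'.hom.comp φ) hslice
  exact ⟨Φ, isTensorMap_of_apply_mul hφ hid hΦ⟩

theorem exists_isTensorMap_right (κ' : EquivRep β' K') {ψ : Y →⋆ₐ[ℂ] Y'}
    (hψ : ZNAction.IsEquivariant β β' ψ) :
    ∃ Ψ, IsTensorMap hω θ κ θ κ' (StarAlgHom.id ℂ X) ψ Ψ := by
  have hid : ZNAction.IsEquivariant α α (StarAlgHom.id ℂ X) := fun _ _ => rfl
  have hslice : ∀ x y e f, ∃ z,
      κ.hom z = HilbertTensor.slice e f ((Braided ω θ κ).subtype (j₁ hω θ κ x * j₂ hω θ κ y)) ∧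
      (κ'.hom.comp ψ) z =
        HilbertTensor.slice e f ((Braided ω θ κ').subtype (j₁ hω θ κ' x * j₂ hω θ κ' (ψ y))) :=
    fun x y e f => ⟨_, (slice_subtype hω θ κ x y e f).symm, by
      simp only [slice_subtype, StarAlgHom.comp_apply, map_sum, map_smul,
        ZNAction.map_component hψ]⟩
  obtain ⟨Ψ, hΨ⟩ := HilbertTensor.exists_starAlgHom_of_slice
    (a' := (j₁ hω θ κ').comp (StarAlgHom.id ℂ X)) (b' := (j₂ hω θ κ').comp ψ)
    (topologicalClosure_spanMul hω θ κ) (spanMul_prod_swap hid hψ) (Braided ω θ κ).subtype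
    (π' := (Braided ω θ κ').subtype) Subtype.val_injective κ.injective (κ'.hom.comp ψ) hslice
  exact ⟨Ψ, isTensorMap_of_apply_mul hid hψ hΨ⟩

end Braided

/-! ### The comultiplication -/

theorem map_mem_unitary_of_mem {N : ℕ} [NeZero N] {A B : Type*} [Ring A] [StarRing A] [Algebra ℂ A]
    [StarModule ℂ A] [Ring B] [StarRing B] [Algebra ℂ B] [StarModule ℂ B] (φ : A →⋆ₐ[ℂ] B)
    {v : Matrix (ZMod N) (ZMod N) A} (hv : v ∈ unitary (Matrix (ZMod N) (ZMod N) A)) :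
    v.map φ ∈ unitary (Matrix (ZMod N) (ZMod N) B) := by
  refine (map_mem_unitary_iff φ v).mpr ?_
  rintro r ⟨i, j, rfl | rfl⟩
  · rw [(Unitary.mem_iff.mp hv).1, sub_self, Matrix.zero_apply, map_zero]
  · rw [(Unitary.mem_iff.mp hv).2, sub_self, Matrix.zero_apply, map_zero]

namespace Braided

variable {N : ℕ} [NeZero N] {ω : ℂ} {X Y : Type*} [CStarAlgebra X] [CStarAlgebra Y]
  {α : ZNAction N X} {β : ZNAction N Y}
  {L K : Type*} [NormedAddCommGroup L] [InnerProductSpace ℂ L] [CompleteSpace L]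
  [NormedAddCommGroup K] [InnerProductSpace ℂ K] [CompleteSpace K]
  (hω : IsPrimitiveRoot ω N) (θ : EquivRep α L) (κ : EquivRep β K)
  {v : Matrix (ZMod N) (ZMod N) X} {w : Matrix (ZMod N) (ZMod N) Y}

/-- The matrix `j₁(v) j₂(w)` over `X ⊠ Y`, with entries `∑ k, j₁(v i k) j₂(w k j)`. -/
def matMul (v : Matrix (ZMod N) (ZMod N) X) (w : Matrix (ZMod N) (ZMod N) Y) :
    Matrix (ZMod N) (ZMod N) (Braided ω θ κ) :=
  v.map (j₁ hω θ κ) * w.map (j₂ hω θ κ)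

theorem matMul_apply (v : Matrix (ZMod N) (ZMod N) X) (w : Matrix (ZMod N) (ZMod N) Y)
    (i j : ZMod N) :
    matMul hω θ κ v w i j = ∑ k, j₁ hω θ κ (v i k) * j₂ hω θ κ (w k j) := rfl

theorem matMul_mem_unitary (hv : v ∈ unitary (Matrix (ZMod N) (ZMod N) X))
    (hw : w ∈ unitary (Matrix (ZMod N) (ZMod N) Y)) :
    matMul hω θ κ v w ∈ unitary (Matrix (ZMod N) (ZMod N) (Braided ω θ κ)) :=
  Submonoid.mul_mem _ (map_mem_unitary_of_mem _ hv) (map_mem_unitary_of_mem _ hw)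

theorem isHomogeneous_matMul (hv : ∀ i j, α.IsHomogeneous ω (j - i) (v i j))
    (hw : ∀ i j, β.IsHomogeneous ω (j - i) (w i j)) (i j : ZMod N) :
    (action hω θ κ).IsHomogeneous ω (j - i) (matMul hω θ κ v w i j) :=
  ZNAction.IsHomogeneous.sum fun k _ => by
    have h := ((hv i k).map (j₁_equivariant hω θ κ)).mul hω
      ((hw k j).map (j₂_equivariant hω θ κ))
    rwa [sub_add_sub_cancel'] at h

-- The twist `ω ^ (-i (j - i))` in `twistedConj` is what absorbs the braiding phase
-- `ω ^ ((k - i) (k - j))` from reversing the product `j₁(v i k) j₂(w k j)`.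
theorem twistedConj_matMul (hv : ∀ i j, α.IsHomogeneous ω (j - i) (v i j))
    (hw : ∀ i j, β.IsHomogeneous ω (j - i) (w i j)) :
    twistedConj ω (matMul hω θ κ v w) =
      matMul hω θ κ (twistedConj ω v) (twistedConj ω w) := by
  ext1 i j
  rw [matMul_apply, twistedConj, Matrix.of_apply, matMul_apply, star_sum, Finset.smul_sum]
  refine Finset.sum_congr rfl fun k _ => ?_
  have hswap := j₂_mul_j₁ hω θ κ ((hv i k).star hω) (star (w k j))
  rw [((hw k j).star hω) _] at hswap
  rw [star_mul, ← map_star, ← map_star, hswap, twistedConj, twistedConj, Matrix.of_apply,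
    Matrix.of_apply, map_smul, map_smul, map_smul, mul_smul_comm, smul_mul_assoc, mul_smul_comm,
    smul_smul, smul_smul, ← chi_add hω, ← chi_add hω]
  congr 2
  ring

end Braided

namespace FreeUnitary

variable {N : ℕ} [NeZero N] {ω : ℂ} (hω : IsPrimitiveRoot ω N)

theorem isHomogeneous_u (i j : ZMod N) :
    (action hω).IsHomogeneous ω (j - i) (u N ω i j) := fun t => rot_u hω t i j

theorem isEquivariant_of_isHomogeneous {B : Type*} [CStarAlgebra B] {β : ZNAction N B}
    {φ : FreeUnitary N ω →⋆ₐ[ℂ] B}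
    (hφ : ∀ i j, β.IsHomogeneous ω (j - i) (φ (u N ω i j))) :
    ZNAction.IsEquivariant (action hω) β φ := fun x t => by
  have h : (β.ρAt t).comp φ = φ.comp ((action hω).ρAt t) := hom_ext fun i j => by
    rw [StarAlgHom.comp_apply, StarAlgHom.comp_apply, ZNAction.ρAt_apply, ZNAction.ρAt_apply, hφ,
      isHomogeneous_u hω, map_smul]
  exact DFunLike.congr_fun h x

variable {L : Type*} [NormedAddCommGroup L] [InnerProductSpace ℂ L] [CompleteSpace L]
  (θ : EquivRep (action hω) L)

/-- The comultiplication of `C(U_N^+(R))`. -/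
def comul : FreeUnitary N ω →⋆ₐ[ℂ] Braided ω θ θ :=
  lift (Braided.matMul hω θ θ (u N ω) (u N ω))
    (Braided.matMul_mem_unitary hω θ θ (u_mem_unitary N ω) (u_mem_unitary N ω)) (by
      rw [Braided.twistedConj_matMul hω θ θ (isHomogeneous_u hω) (isHomogeneous_u hω)]
      exact Braided.matMul_mem_unitary hω θ θ (twistedConj_u_mem_unitary N ω)
        (twistedConj_u_mem_unitary N ω))

theorem comul_u (i j : ZMod N) :
    comul hω θ (u N ω i j) =
      ∑ k, Braided.j₁ hω θ θ (u N ω i k) * Braided.j₂ hω θ θ (u N ω k j) :=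
  lift_u _ _ _ i j

theorem map_comul_u :
    (u N ω).map (comul hω θ) = Braided.matMul hω θ θ (u N ω) (u N ω) :=
  Matrix.ext fun i j => comul_u hω θ i j

theorem map_comul_twistedConj_u :
    (twistedConj ω (u N ω)).map (comul hω θ) =
      Braided.matMul hω θ θ (twistedConj ω (u N ω)) (twistedConj ω (u N ω)) := by
  rw [map_twistedConj, map_comul_u,
    Braided.twistedConj_matMul hω θ θ (isHomogeneous_u hω) (isHomogeneous_u hω)]

theorem comul_equivariant :
    ZNAction.IsEquivariant (action hω) (Braided.action hω θ θ) (comul hω θ) :=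
  isEquivariant_of_isHomogeneous hω fun i j => by
    rw [comul_u]
    exact Braided.isHomogeneous_matMul hω θ θ (isHomogeneous_u hω) (isHomogeneous_u hω) i j

end FreeUnitary

/-! ### Coassociativity -/

namespace HilbertTensor

variable {E F G : Type*} [NormedAddCommGroup E] [InnerProductSpace ℂ E]
  [NormedAddCommGroup F] [InnerProductSpace ℂ F] [NormedAddCommGroup G] [InnerProductSpace ℂ G]

theorem ext_tmul_tmul {X : Type*} [NormedAddCommGroup X] [NormedSpace ℂ X]
    {S T : HilbertTensor (HilbertTensor E F) G →L[ℂ] X}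
    (h : ∀ x y z, S (tmul (tmul x y) z) = T (tmul (tmul x y) z)) : S = T := by
  refine ext_tmul fun v z => ?_
  have hc (R : HilbertTensor (HilbertTensor E F) G →L[ℂ] X) : Continuous fun v => R (tmul v z) :=
    R.continuous.comp (tmulL_left_continuous z)
  refine denseRange_coeL.induction_on v (isClosed_eq (hc S) (hc T)) fun w => ?_
  induction w using TensorProduct.induction_on with
  | zero => rw [map_zero, zero_tmul, map_zero, map_zero]
  | tmul x y => exact h x y z
  | add a b ha hb => rw [map_add, add_tmul, map_add, map_add, ha, hb]

theorem conj_assoc_map_map [CompleteSpace E] [CompleteSpace F] [CompleteSpace G]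
    (A : E →L[ℂ] E) (B : F →L[ℂ] F) (C : G →L[ℂ] G) :
    (assoc E F G).conjStarAlgEquiv (map (map A B) C) = map A (map B C) := by
  have h : (assoc E F G : _ →L[ℂ] _) ∘L map (map A B) C =
      map A (map B C) ∘L (assoc E F G : _ →L[ℂ] _) := ext_tmul_tmul fun x y z => by
    simp [assoc_tmul]
  ext v
  simpa using DFunLike.congr_fun h ((assoc E F G).symm v)

end HilbertTensor

namespace ZNRep

variable {N : ℕ} [NeZero N] {ω : ℂ} {L K M : Type*} [NormedAddCommGroup L] [InnerProductSpace ℂ L]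
  [CompleteSpace L] [NormedAddCommGroup K] [InnerProductSpace ℂ K] [CompleteSpace K]
  [NormedAddCommGroup M] [InnerProductSpace ℂ M] [CompleteSpace M]

theorem conj_assoc_leg₁_leg₁ (x : L →L[ℂ] L) :
    (HilbertTensor.assoc L K M).conjStarAlgEquiv (leg₁ M (leg₁ K x)) =
      leg₁ (HilbertTensor K M) x := by
  rw [leg₁, leg₁, leg₁, HilbertTensor.conj_assoc_map_map, HilbertTensor.map_one_one]

theorem conj_assoc_leg₁_leg₂ (hω : IsPrimitiveRoot ω N) (U : ZNRep N L) (V : ZNRep N K)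
    (W : ZNRep N M) (y : K →L[ℂ] K) :
    (HilbertTensor.assoc L K M).conjStarAlgEquiv (leg₁ M (leg₂ ω U V y)) =
      leg₂ ω U (V.tensor W) (leg₁ M y) := by
  have h : ((HilbertTensor.assoc L K M).conjStarAlgEquiv.toStarAlgHom.comp
      (leg₁Hom (HilbertTensor L K) M)).comp (leg₂Hom hω U V) =
      (leg₂Hom hω U (V.tensor W)).comp (leg₁Hom K M) :=
    V.opAction.starAlgHom_ext_of_isHomogeneous hω fun n y hy => by
      change (HilbertTensor.assoc L K M).conjStarAlgEquiv (leg₁ M (leg₂ ω U V y)) =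
        leg₂ ω U (V.tensor W) (leg₁ M y)
      have hy' : (V.tensor W).opAction.IsHomogeneous ω n (leg₁ M y) :=
        hy.map (leg₁Hom_equivariant V W)
      rw [leg₂_of_degree hω U V hy, leg₂_of_degree hω U _ hy', leg₁, leg₁,
        HilbertTensor.conj_assoc_map_map]
  exact DFunLike.congr_fun h y

theorem conj_assoc_leg₂ (hω : IsPrimitiveRoot ω N) (U : ZNRep N L) (V : ZNRep N K)
    (W : ZNRep N M) (z : M →L[ℂ] M) :
    (HilbertTensor.assoc L K M).conjStarAlgEquiv (leg₂ ω (U.tensor V) W z) =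
      leg₂ ω U (V.tensor W) (leg₂ ω V W z) := by
  have h : (HilbertTensor.assoc L K M).conjStarAlgEquiv.toStarAlgHom.comp
      (leg₂Hom hω (U.tensor V) W) = (leg₂Hom hω U (V.tensor W)).comp (leg₂Hom hω V W) :=
    W.opAction.starAlgHom_ext_of_isHomogeneous hω fun n z hz => by
      change (HilbertTensor.assoc L K M).conjStarAlgEquiv (leg₂ ω (U.tensor V) W z) =
        leg₂ ω U (V.tensor W) (leg₂ ω V W z)
      have hz' : (V.tensor W).opAction.IsHomogeneous ω n (leg₂ ω V W z) :=
        hz.map (leg₂Hom_equivariant hω V W)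
      rw [leg₂_of_degree hω _ W hz, leg₂_of_degree hω U _ hz', leg₂_of_degree hω V W hz]
      exact HilbertTensor.conj_assoc_map_map _ _ _
  exact DFunLike.congr_fun h z

end ZNRep

namespace FreeUnitary

variable {N : ℕ} [NeZero N] {ω : ℂ} {L : Type*} [NormedAddCommGroup L] [InnerProductSpace ℂ L]
  [CompleteSpace L]

theorem comul_coassoc (hω : IsPrimitiveRoot ω N) (θ : EquivRep (action hω) L)
    {Φ : Braided ω θ θ →⋆ₐ[ℂ] Braided ω (Braided.rep hω θ θ) θ}
    {Ψ : Braided ω θ θ →⋆ₐ[ℂ] Braided ω θ (Braided.rep hω θ θ)}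
    (hΦ : Braided.IsTensorMap hω θ θ (Braided.rep hω θ θ) θ (comul hω θ) (StarAlgHom.id ℂ _) Φ)
    (hΨ : Braided.IsTensorMap hω θ θ θ (Braided.rep hω θ θ) (StarAlgHom.id ℂ _) (comul hω θ) Ψ)
    (x : FreeUnitary N ω) :
    (HilbertTensor.assoc L L L).conjStarAlgEquiv (Φ (comul hω θ x)).1 = (Ψ (comul hω θ x)).1 := by
  let j₁ := Braided.j₁ hω θ θ
  let j₂ := Braided.j₂ hω θ θ
  let F := (HilbertTensor.assoc L L L).conjStarAlgEquiv.toStarAlgHom.comp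
    (Braided ω (Braided.rep hω θ θ) θ).subtype
  let G := (Braided ω θ (Braided.rep hω θ θ)).subtype
  let F₁ := F.comp (Braided.j₁ hω (Braided.rep hω θ θ) θ)
  let F₂ := F.comp (Braided.j₂ hω (Braided.rep hω θ θ) θ)
  let G₁ := G.comp (Braided.j₁ hω θ (Braided.rep hω θ θ))
  let G₂ := G.comp (Braided.j₂ hω θ (Braided.rep hω θ θ))
  have first (y) : F₁ (j₁ y) = G₁ y := ZNRep.conj_assoc_leg₁_leg₁ _
  have second (y) : F₁ (j₂ y) = G₂ (j₁ y) := ZNRep.conj_assoc_leg₁_leg₂ hω θ.U θ.U θ.U _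
  have third (y) : F₂ y = G₂ (j₂ y) := ZNRep.conj_assoc_leg₂ hω θ.U θ.U θ.U _
  have hF (y z) : F (Φ (j₁ y * j₂ z)) = F₁ (comul hω θ y) * F₂ z := by
    rw [hΦ.apply_mul, map_mul]; rfl
  have hG (y z) : G (Ψ (j₁ y * j₂ z)) = G₁ y * G₂ (comul hω θ z) := by
    rw [hΨ.apply_mul, map_mul]; rfl
  have hgen : (F.comp Φ).comp (comul hω θ) = (G.comp Ψ).comp (comul hω θ) := hom_ext fun i j => by
    calc F (Φ (comul hω θ (u N ω i j)))
        = ∑ k, F₁ (comul hω θ (u N ω i k)) * F₂ (u N ω k j) := by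
          simp only [comul_u hω θ i j, map_sum]
          exact Finset.sum_congr rfl fun k _ => hF _ _
      _ = ∑ k, ∑ l, G₁ (u N ω i l) * G₂ (j₁ (u N ω l k)) * G₂ (j₂ (u N ω k j)) := by
          refine Finset.sum_congr rfl fun k _ => ?_
          rw [comul_u, map_sum, Finset.sum_mul, third]
          refine Finset.sum_congr rfl fun l _ => ?_
          rw [map_mul, first, second]
      _ = ∑ l, G₁ (u N ω i l) * G₂ (comul hω θ (u N ω l j)) := by
          rw [Finset.sum_comm]
          refine Finset.sum_congr rfl fun l _ => ?_
          rw [comul_u, map_sum, Finset.mul_sum]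
          exact Finset.sum_congr rfl fun k _ => by rw [map_mul, mul_assoc]
      _ = G (Ψ (comul hω θ (u N ω i j))) := by
          simp only [comul_u hω θ i j, map_sum]
          exact Finset.sum_congr rfl fun l _ => (hG _ _).symm
  exact DFunLike.congr_fun hgen x

end FreeUnitary

/-! ### Bisimplifiability -/

namespace FreeUnitary

variable {N : ℕ} [NeZero N] {ω : ℂ}

theorem dense_adjoin_range_u : Dense (Algebra.adjoin ℂ
    {x | ∃ i j, x = u N ω i j ∨ x = star (u N ω i j)} : Set (FreeUnitary N ω)) := fun x => by
  refine CStarCompletion.induction _ isClosed_closure (fun a => subset_closure ?_) x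
  change CStarCompletion.ofHom _ a ∈ Algebra.adjoin ℂ _
  induction a using FreeStar.induction with
  | hs c => rw [AlgHomClass.commutes]; exact Subalgebra.algebraMap_mem _ c
  | hl q =>
    rcases q with ⟨⟨i, j⟩, b⟩
    refine Algebra.subset_adjoin ⟨i, j, ?_⟩
    cases b
    · right
      rw [← FreeStar.star_gen, map_star]
      rfl
    · exact Or.inl rfl
  | hm a b iha ihb => rw [map_mul]; exact mul_mem iha ihb
  | ha a b iha ihb => rw [map_add]; exact add_mem iha ihb

theorem star_u_eq_smul (hω : IsPrimitiveRoot ω N) (i j : ZMod N) :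
    star (u N ω i j) = chi ω (i * (j - i)) • twistedConj ω (u N ω) i j := by
  rw [twistedConj, Matrix.of_apply, smul_smul, ← chi_add hω, add_neg_cancel, chi_zero, one_smul]

theorem u_eq_smul_star (hω : IsPrimitiveRoot ω N) (i j : ZMod N) :
    u N ω i j = chi ω (-(i * (j - i))) • star (twistedConj ω (u N ω) i j) := by
  rw [← star_chi hω, ← star_smul, ← star_u_eq_smul hω, star_star]

variable {L : Type*} [NormedAddCommGroup L] [InnerProductSpace ℂ L] [CompleteSpace L]
  (hω : IsPrimitiveRoot ω N) (θ : EquivRep (action hω) L)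
  {w : Matrix (ZMod N) (ZMod N) (FreeUnitary N ω)}

theorem j₁_eq_sum (hw : w ∈ unitary (Matrix (ZMod N) (ZMod N) (FreeUnitary N ω)))
    (hΔ : w.map (comul hω θ) = Braided.matMul hω θ θ w w) (i k : ZMod N) :
    Braided.j₁ hω θ θ (w i k) =
      ∑ j, comul hω θ (w i j) * Braided.j₂ hω θ θ (star (w k j)) := by
  have h : w.map (comul hω θ) * star (w.map (Braided.j₂ hω θ θ)) = w.map (Braided.j₁ hω θ θ) := by
    rw [hΔ, Braided.matMul, mul_assoc,
      (Unitary.mem_iff.mp (map_mem_unitary_of_mem (Braided.j₂ hω θ θ) hw)).2, mul_one]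
  refine (congrFun (congrFun h i) k).symm.trans (Finset.sum_congr rfl fun j _ => ?_)
  rw [map_star]
  rfl

theorem j₂_star_eq_sum (hw : w ∈ unitary (Matrix (ZMod N) (ZMod N) (FreeUnitary N ω)))
    (hΔ : w.map (comul hω θ) = Braided.matMul hω θ θ w w) (k j : ZMod N) :
    Braided.j₂ hω θ θ (star (w k j)) =
      ∑ i, comul hω θ (star (w i j)) * Braided.j₁ hω θ θ (w i k) := by
  have h : star (w.map (comul hω θ)) * w.map (Braided.j₁ hω θ θ) =
      star (w.map (Braided.j₂ hω θ θ)) := by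
    rw [hΔ, Braided.matMul, star_mul, mul_assoc,
      (Unitary.mem_iff.mp (map_mem_unitary_of_mem (Braided.j₁ hω θ θ) hw)).1, mul_one]
  rw [map_star]
  refine (congrFun (congrFun h j) k).symm.trans (Finset.sum_congr rfl fun i _ => ?_)
  rw [map_star]
  rfl

theorem j₁_mem_spanMul (hw : w ∈ unitary (Matrix (ZMod N) (ZMod N) (FreeUnitary N ω)))
    (hΔ : w.map (comul hω θ) = Braided.matMul hω θ θ w w) (i k : ZMod N) :
    Braided.j₁ hω θ θ (w i k) ∈ spanMul (comul hω θ) (Braided.j₂ hω θ θ) := by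
  rw [j₁_eq_sum hω θ hw hΔ]
  exact Submodule.sum_mem _ fun j _ => map_mul_map_mem_spanMul _ _

theorem j₂_star_mem_spanMul (hw : w ∈ unitary (Matrix (ZMod N) (ZMod N) (FreeUnitary N ω)))
    (hΔ : w.map (comul hω θ) = Braided.matMul hω θ θ w w) (k j : ZMod N) :
    Braided.j₂ hω θ θ (star (w k j)) ∈ spanMul (comul hω θ) (Braided.j₁ hω θ θ) := by
  rw [j₂_star_eq_sum hω θ hw hΔ]
  exact Submodule.sum_mem _ fun i _ => map_mul_map_mem_spanMul _ _

theorem topologicalClosure_spanMul_comul_j₂ :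
    (spanMul (comul hω θ) (Braided.j₂ hω θ θ)).topologicalClosure = ⊤ := by
  have hle : spanMul (Braided.j₁ hω θ θ) (Braided.j₂ hω θ θ) ≤
      (spanMul (comul hω θ) (Braided.j₂ hω θ θ)).topologicalClosure := by
    refine spanMul_le_topologicalClosure_spanMul dense_adjoin_range_u ?_ ?_
    · rintro _ ⟨i, j, rfl | rfl⟩
      · exact j₁_mem_spanMul hω θ (u_mem_unitary N ω) (map_comul_u hω θ) i j
      · rw [star_u_eq_smul hω, map_smul]
        exact Submodule.smul_mem _ _ (j₁_mem_spanMul hω θ (twistedConj_u_mem_unitary N ω)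
          (map_comul_twistedConj_u hω θ) i j)
    · rintro _ ⟨i, j, rfl | rfl⟩ y
      · exact ⟨_, Braided.j₂_mul_j₁ hω θ θ (isHomogeneous_u hω i j) y⟩
      · exact ⟨_, Braided.j₂_mul_j₁ hω θ θ ((isHomogeneous_u hω i j).star hω) y⟩
  rw [eq_top_iff, ← Braided.topologicalClosure_spanMul hω θ θ]
  exact Submodule.topologicalClosure_minimal _ hle (Submodule.isClosed_topologicalClosure _)

theorem topologicalClosure_spanMul_comul_j₁ :
    (spanMul (comul hω θ) (Braided.j₁ hω θ θ)).topologicalClosure = ⊤ := by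
  have hle : spanMul (Braided.j₂ hω θ θ) (Braided.j₁ hω θ θ) ≤
      (spanMul (comul hω θ) (Braided.j₁ hω θ θ)).topologicalClosure := by
    refine spanMul_le_topologicalClosure_spanMul dense_adjoin_range_u ?_ ?_
    · rintro _ ⟨i, j, rfl | rfl⟩
      · rw [u_eq_smul_star hω, map_smul]
        exact Submodule.smul_mem _ _ (j₂_star_mem_spanMul hω θ (twistedConj_u_mem_unitary N ω)
          (map_comul_twistedConj_u hω θ) i j)
      · exact j₂_star_mem_spanMul hω θ (u_mem_unitary N ω) (map_comul_u hω θ) i j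
    · rintro _ ⟨i, j, rfl | rfl⟩ x
      · exact ⟨_, Braided.j₁_mul_j₂ hω θ θ x (isHomogeneous_u hω i j)⟩
      · exact ⟨_, Braided.j₁_mul_j₂ hω θ θ x ((isHomogeneous_u hω i j).star hω)⟩
  rw [eq_top_iff, ← Braided.topologicalClosure_spanMul hω θ θ, ← Braided.spanMul_j₂_j₁]
  exact Submodule.topologicalClosure_minimal _ hle (Submodule.isClosed_topologicalClosure _)

end FreeUnitary

end

theorem proposition2 {N : ℕ} [NeZero N] {ω : ℂ} (hω : IsPrimitiveRoot ω N) :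
    (∃ (L : Type) (_ : NormedAddCommGroup L) (_ : InnerProductSpace ℂ L) (_ : CompleteSpace L),
      Nonempty (EquivRep (FreeUnitary.action hω) L)) ∧
    ∀ (L : Type*) [NormedAddCommGroup L] [InnerProductSpace ℂ L] [CompleteSpace L]
      (θ : EquivRep (FreeUnitary.action hω) L),
      ∃ Δ : FreeUnitary N ω →⋆ₐ[ℂ] Braided ω θ θ,
        (∀ i j, Δ (FreeUnitary.u N ω i j) = ∑ k, Braided.j₁ hω θ θ (FreeUnitary.u N ω i k) *
          Braided.j₂ hω θ θ (FreeUnitary.u N ω k j)) ∧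
        (∀ Δ' : FreeUnitary N ω →⋆ₐ[ℂ] Braided ω θ θ,
          (∀ i j, Δ' (FreeUnitary.u N ω i j) = ∑ k, Braided.j₁ hω θ θ (FreeUnitary.u N ω i k) *
            Braided.j₂ hω θ θ (FreeUnitary.u N ω k j)) → Δ' = Δ) ∧
        IsAnyonicCQG hω θ Δ := by
  refine ⟨(FreeUnitary.action hω).exists_equivRep, fun L _ _ _ θ => ?_⟩
  have hequiv := FreeUnitary.comul_equivariant hω θ
  obtain ⟨Φ, hΦ⟩ := Braided.exists_isTensorMap_left hω θ θ (Braided.rep hω θ θ) hequiv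
  obtain ⟨Ψ, hΨ⟩ := Braided.exists_isTensorMap_right hω θ θ (Braided.rep hω θ θ) hequiv
  refine ⟨FreeUnitary.comul hω θ, FreeUnitary.comul_u hω θ, fun Δ' h => FreeUnitary.hom_ext
    fun i j => (h i j).trans (FreeUnitary.comul_u hω θ i j).symm, ?_⟩
  exact
    { equivariant := hequiv
      coassoc := ⟨Φ, Ψ, hΦ, hΨ, fun x ξ => by
        have h := DFunLike.congr_fun (FreeUnitary.comul_coassoc hω θ hΦ hΨ x)
          (HilbertTensor.assoc L L L ξ)
        rwa [LinearIsometryEquiv.conjStarAlgEquiv_apply_apply,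
          LinearIsometryEquiv.symm_apply_apply] at h⟩
      bisimplifiable_right := FreeUnitary.topologicalClosure_spanMul_comul_j₂ hω θ
      bisimplifiable_left := FreeUnitary.topologicalClosure_spanMul_comul_j₁ hω θ }
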